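/- There is a universal constant $C>0$ such that the following hold. Throughout, $\varepsilon>0$ is a real number, $k,n$ are nonnegative integers, $X=(X_1,\dots,X_n)$ is a vector of independent standard Gaussians, and $Y=(Y_1,\dots,Y_n)$ is a vector of $k$-wise independent standard Gaussians: each $Y_i$ is a standard Gaussian and any at most $k$ of the $Y_i$ are mutually independent. Write $\mathrm{sgn}(t)=-1$ for $t<0$ and $\mathrm{sgn}(t)=1$ for $t\ge 0$. 1. Let $m>1$ be an integer and let $H_i=\{x\in\mathbb{R}^n:\langle a_i,x\rangle>\theta_i\}$ for $i=1,\dots,m$, with $\|a_i\|_2=1$ and $\theta_i\in\mathbb{R}$. If $k\ge C\,m^6/\varepsilon^2$, then $$\Bigl|\Pr\bigl[X\in\textstyle\bigcap_{i=1}^m H_i\bigr]-\Pr\bigl[Y\in\bigcap_{i=1}^m H_i\bigr]\Bigr|<\varepsilon .$$ 2. In particular, for two halfspaces $H_1=\{x:\langle a,x\rangle>\theta_1\}$ and $H_2=\{x:\langle b,x\rangle>\theta_2\}$ with $\|a\|_2=\|b\|_2=1$: if $k\ge C/\varepsilon^2$, then $|\Pr[X\in H_1\cap H_2]-\Pr[Y\in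 H_1\cap H_2]|<\varepsilon$. 3. (Hyperplane rounding is fooled.) If $k\ge C/\varepsilon^2$, then for all $a,b\in\mathbb{R}^n$ with $\|a\|_2=\|b\|_2=1$, $$\bigl|\Pr[\mathrm{sgn}\langle a,X\rangle\ne\mathrm{sgn}\langle b,X\rangle]-\Pr[\mathrm{sgn}\langle a,Y\rangle\ne\mathrm{sgn}\langle b,Y\rangle]\bigr|<\varepsilon .$$ 4. (Goemans–Williamson rounding for MaxCut.) Let $G=(V,E)$ be a finite simple graph with nonnegative edge weights $w$ (for instance all equal to $1$), let $\mathrm{OPT}$ be the maximum total weight of the edges cut by a bipartition of $V$, and let $(x_u)_{u\in V}$ be unit vectors in $\mathbb{R}^n$ that maximize $\sum_{uv\in E}w_{uv}\frac{1-\langle x_u,x_v\rangle}{2}$ over all assignments of unit vectors of $\mathbb{R}^n$ to $V$. If $k\ge C/\varepsilon^2$ and each vertex $u$ is placed on the side $\mathrm{sgn}\langle x_u,Y\rangle$, then the expected total weight of the cut edges is at least $(\alpha-\varepsilon)\,\mathrm{OPT}$, where $\alpha=\min_{0<\varphi\le\pi}\frac{2}{\pi}\cdot\frac{\varphi}{1-\cos\varphi}$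 is the Goemans–Williamson constant ($0.878\ldots$). -/

import Mathlib

open MeasureTheory ProbabilityTheory

/-- The coordinates of the random vector `X` are independent standard normals. -/
structure IsIndepStdGaussianVector {Ω : Type*} [MeasurableSpace Ω] {n : ℕ}
    (X : Ω → EuclideanSpace ℝ (Fin n)) (μ : Measure Ω) : Prop where
  hasLaw : ∀ i, HasLaw (fun ω => X ω i) (gaussianReal 0 1) μ
  indep : iIndepFun (fun (i : Fin n) (ω : Ω) => X ω i) μ

/-- The coordinates of the random vector `Y` are `k`-wise independent standard normals: each is a
standard normal, and any at most `k` of them are (mutually) independent. -/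
structure IsKWiseIndepStdGaussianVector {Ω : Type*} [MeasurableSpace Ω] {n : ℕ} (k : ℕ)
    (Y : Ω → EuclideanSpace ℝ (Fin n)) (μ : Measure Ω) : Prop where
  hasLaw : ∀ i, HasLaw (fun ω => Y ω i) (gaussianReal 0 1) μ
  indep : ∀ s : Finset (Fin n), s.card ≤ k →
    iIndepFun (fun (i : s) (ω : Ω) => Y ω (i : Fin n)) μ

/-- The open halfspace `{x : ⟨a, x⟩ > θ}`. -/
def halfspace {n : ℕ} (a : EuclideanSpace ℝ (Fin n)) (θ : ℝ) : Set (EuclideanSpace ℝ (Fin n)) :=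
  {x | θ < inner ℝ a x}

/-- The sign function with values in `{-1, 1}`: `-1` on negative numbers and `1` otherwise. -/
noncomputable def sgn (t : ℝ) : ℝ := if t < 0 then -1 else 1

open Classical in
/-- Total weight of the edges of `G` that are cut by the partition `σ` of the vertices, where `σ`
assigns to each vertex the label of its side. -/
noncomputable def cutWeight {V : Type*} [Fintype V] (G : SimpleGraph V) (w : Sym2 V → ℝ)
    (σ : V → ℝ) : ℝ :=
  ∑ e ∈ G.edgeFinset with (∃ u v, e = s(u, v) ∧ σ u ≠ σ v), w e

/-- The maximum weight of a cut, over all bipartitions of the vertices (described by the indicator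
function of one side). -/
noncomputable def maxCut {V : Type*} [Fintype V] (G : SimpleGraph V) (w : Sym2 V → ℝ) : ℝ :=
  ⨆ S : Set V, cutWeight G w (S.indicator 1)

open Classical in
/-- Objective `∑_{uv ∈ E} w(uv) (1 - ⟨x_u, x_v⟩) / 2` of the semidefinite relaxation. -/
noncomputable def sdpValue {V : Type*} [Fintype V] {n : ℕ} (G : SimpleGraph V) (w : Sym2 V → ℝ)
    (x : V → EuclideanSpace ℝ (Fin n)) : ℝ :=
  ∑ e ∈ G.edgeFinset, w e * Sym2.lift
    ⟨fun u v => (1 - inner ℝ (x u) (x v)) / 2, fun u v => by simp only [real_inner_comm]⟩ e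

/-- `x` assigns unit vectors to the vertices, and maximizes the semidefinite relaxation among all
such assignments. -/
def IsOptimalSdpSolution {V : Type*} [Fintype V] {n : ℕ} (G : SimpleGraph V) (w : Sym2 V → ℝ)
    (x : V → EuclideanSpace ℝ (Fin n)) : Prop :=
  (∀ u, ‖x u‖ = 1) ∧
    ∀ y : V → EuclideanSpace ℝ (Fin n), (∀ u, ‖y u‖ = 1) → sdpValue G w y ≤ sdpValue G w x

/-- The Goemans-Williamson constant `min_{0 < φ ≤ π} (2 / π) * φ / (1 - cos φ) = 0.878...`. -/
noncomputable def goemansWilliamsonConstant : ℝ :=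
  sInf ((fun φ : ℝ => 2 / Real.pi * (φ / (1 - Real.cos φ))) '' Set.Ioc 0 Real.pi)

/-! The indicator of an intersection of halfspaces is replaced by a product of smooth steps
`smoothStep (T * (⟨a i, x⟩ - θ i))`. The step is a normalized primitive of sinc⁴, hence band-limited
up to a constant: its `j`-th derivative is at most `B ^ j`, with no factorial. Along a ray through
`x` the product therefore has `j`-th derivative at most `(T B ∑ |⟨a i, x⟩|) ^ j`.

Expand at the origin to degree `l` with `l + 1 ≤ k` even. Polynomials of degree at most `k` have the
same mean under `Y` as under the Gaussian, because a monomial involves at most `k` coordinates. The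
remainder is controlled by the moments of order `l + 1` of `⟨a i, Y⟩`, which are also Gaussian; it
is exponentially small if `T B m ≤ e^(-3/2) √(l + 1)` (`integral_abs_sub_taylorPoly_le`,
`abs_integral_sub_le`).

The smoothing error is at most a constant times `∑ sincEnvelope (T * (⟨a i, x⟩ - θ i))`. Under the
Gaussian each term has mean `O(1 / T)`, the density being bounded. No anticoncentration is known in
advance for `Y`, but the envelope itself is of exponential type, so it is fooled too and the bound
transfers to `Y`. With `T` of order `√k / m` the total error is `O(m² / √k)`
(`abs_measureReal_halfspaces_sub_le`), which is stronger than the required rate in `m`.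

Sign disagreement is a symmetric difference of two halfspaces, so it is fooled by
inclusion-exclusion. For MaxCut, a Gaussian separates unit vectors at angle `φ` with probability at
least `φ / π`. The additive loss per edge sums to at most a multiple of `maxCut`, because a
uniformly random cut has half the total weight. -/

/-! ### Functions of exponential type on the line -/

/-- `f` is smooth and its `j`-th derivative is bounded by `B ^ j`, for all `j`. -/
structure HasExpDerivBound (B : ℝ) (f : ℝ → ℝ) : Prop where
  contDiff : ContDiff ℝ (⊤ : ℕ∞) f
  bound : ∀ j t, |iteratedDeriv j f t| ≤ B ^ j

namespace HasExpDerivBound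

variable {A B : ℝ} {f g : ℝ → ℝ}

lemma contDiffAt (hf : HasExpDerivBound B f) (j : ℕ) (t : ℝ) : ContDiffAt ℝ j f t :=
  (hf.contDiff.of_le (by exact_mod_cast le_top)).contDiffAt

lemma nonneg (hf : HasExpDerivBound B f) : 0 ≤ B := by
  simpa using (abs_nonneg _).trans (hf.bound 1 0)

lemma abs_le_one (hf : HasExpDerivBound B f) (t : ℝ) : |f t| ≤ 1 := by
  simpa using hf.bound 0 t

lemma mono (hf : HasExpDerivBound A f) (h : A ≤ B) : HasExpDerivBound B f :=
  ⟨hf.contDiff, fun j t => (hf.bound j t).trans (pow_le_pow_left₀ hf.nonneg h j)⟩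

/-- Leibniz's rule produces exactly the binomial expansion of `(A + B) ^ j`, so types add under
products. -/
lemma mul (hf : HasExpDerivBound A f) (hg : HasExpDerivBound B g) :
    HasExpDerivBound (A + B) (fun t => f t * g t) := by
  refine ⟨hf.contDiff.mul hg.contDiff, fun j t => ?_⟩
  have := iteratedDeriv_mul (hf.contDiffAt j t) (hg.contDiffAt j t)
  change |iteratedDeriv j (f * g) t| ≤ _
  rw [this, add_pow]
  refine (Finset.abs_sum_le_sum_abs _ _).trans (Finset.sum_le_sum fun i _ => ?_)
  rw [abs_mul, abs_mul, Nat.abs_cast]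
  calc (j.choose i : ℝ) * |iteratedDeriv i f t| * |iteratedDeriv (j - i) g t|
      ≤ (j.choose i : ℝ) * A ^ i * B ^ (j - i) := by
        have := hf.bound i t
        have := hg.bound (j - i) t
        have := hf.nonneg
        gcongr
    _ = _ := by ring

lemma one : HasExpDerivBound 0 (fun _ => 1) := by
  refine ⟨contDiff_const, fun j t => ?_⟩
  rcases j with _ | j
  · simp
  · simp [iteratedDeriv_const]

lemma prod {ι : Type*} (s : Finset ι) {B : ι → ℝ} {f : ι → ℝ → ℝ}
    (h : ∀ i ∈ s, HasExpDerivBound (B i) (f i)) :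
    HasExpDerivBound (∑ i ∈ s, B i) (fun t => ∏ i ∈ s, f i t) := by
  classical
  induction s using Finset.induction_on with
  | empty => simpa using one
  | insert i s hi ih =>
    simp only [Finset.sum_insert hi, Finset.prod_insert hi]
    exact (h i (Finset.mem_insert_self i s)).mul
      (ih fun j hj => h j (Finset.mem_insert_of_mem hj))

lemma comp_mul_add (hf : HasExpDerivBound B f) (c d : ℝ) :
    HasExpDerivBound (|c| * B) (fun t => f (c * t + d)) := by
  have hd : ContDiff ℝ (⊤ : ℕ∞) (fun t => f (t + d)) := hf.contDiff.comp (by fun_prop)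
  refine ⟨hf.contDiff.comp (by fun_prop), fun j t => ?_⟩
  have h1 := iteratedDeriv_comp_const_mul (n := j) (f := fun t => f (t + d))
    (hd.of_le (by exact_mod_cast le_top)) c
  simp only [iteratedDeriv_comp_add_const] at h1
  rw [h1, abs_mul, abs_pow, mul_pow]
  gcongr
  exact hf.bound _ _

/-- Averaging, unlike adding, keeps the leading constant of the bound equal to 1. -/
lemma midpoint (hf : HasExpDerivBound B f) (hg : HasExpDerivBound B g) :
    HasExpDerivBound B (fun t => 2⁻¹ * (f t + g t)) := by
  refine ⟨contDiff_const.mul (hf.contDiff.add hg.contDiff), fun j t => ?_⟩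
  rw [iteratedDeriv_const_mul_field]
  have := iteratedDeriv_add (hf.contDiffAt j t) (hg.contDiffAt j t)
  change |2⁻¹ * iteratedDeriv j (f + g) t| ≤ _
  rw [this, abs_mul, abs_of_pos (by norm_num : (0 : ℝ) < 2⁻¹)]
  have := abs_add_le (iteratedDeriv j f t) (iteratedDeriv j g t)
  linarith [hf.bound j t, hg.bound j t]

/-- An antiderivative, normalized to be bounded by `1`, again has exponential derivative bounds. -/
lemma of_deriv {F : ℝ → ℝ} {c : ℝ} (hf : HasExpDerivBound B f) (hc : 0 ≤ c)
    (hF : ∀ t, HasDerivAt F (c * f t) t) (hF1 : ∀ t, |F t| ≤ 1) (hcB : c ≤ B) :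
    HasExpDerivBound B F := by
  have hd : deriv F = fun t => c * f t := funext fun t => (hF t).deriv
  constructor
  · rw [contDiff_infty_iff_deriv, hd]
    exact ⟨fun t => (hF t).differentiableAt, contDiff_const.mul hf.contDiff⟩
  · intro j t
    rcases j with _ | j
    · simpa using hF1 t
    · rw [iteratedDeriv_succ', hd, iteratedDeriv_const_mul_field, abs_mul, abs_of_nonneg hc,
        pow_succ']
      have := hf.bound j t
      have := hf.nonneg
      gcongr

end HasExpDerivBound

/-! ### The cardinal sine and its envelope -/

/-- For `j = 0` the integral is `sinc t`, the Fourier representation on a bounded band. Each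
derivative brings out a factor `ξ` and advances the phase by `π / 2`, so one formula covers all
orders. -/
lemma hasDerivAt_integral_pow_mul_cos (j : ℕ) (t : ℝ) :
    HasDerivAt (fun t => ∫ ξ in (0 : ℝ)..1, ξ ^ j * Real.cos (t * ξ + j * (Real.pi / 2)))
      (∫ ξ in (0 : ℝ)..1,
        ξ ^ (j + 1) * Real.cos (t * ξ + (j + 1 : ℕ) * (Real.pi / 2))) t := by
  refine (intervalIntegral.hasDerivAt_integral_of_dominated_loc_of_deriv_le
    (F := fun t ξ => ξ ^ j * Real.cos (t * ξ + j * (Real.pi / 2)))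
    (F' := fun t ξ => ξ ^ (j + 1) * Real.cos (t * ξ + (j + 1 : ℕ) * (Real.pi / 2)))
    (bound := fun _ => 1) (s := Set.univ) Filter.univ_mem ?_ ?_ ?_ ?_ ?_ ?_).2
  · exact Filter.Eventually.of_forall fun t =>
      (by fun_prop : Continuous _).aestronglyMeasurable
  · exact (by fun_prop : Continuous _).intervalIntegrable _ _
  · exact (by fun_prop : Continuous _).aestronglyMeasurable
  · refine Filter.Eventually.of_forall fun ξ hξ t _ => ?_
    rw [Set.uIoc_of_le zero_le_one] at hξ
    rw [Real.norm_eq_abs, abs_mul, abs_pow, abs_of_pos hξ.1]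
    exact mul_le_one₀ (pow_le_one₀ hξ.1.le hξ.2) (abs_nonneg _) (Real.abs_cos_le_one _)
  · exact intervalIntegrable_const
  · refine Filter.Eventually.of_forall fun ξ hξ t _ => ?_
    have h1 : HasDerivAt (fun t : ℝ => t * ξ + j * (Real.pi / 2)) ξ t := by
      simpa using ((hasDerivAt_id t).mul_const ξ).add_const (j * (Real.pi / 2))
    have h2 := (h1.cos).const_mul (ξ ^ j)
    refine h2.congr_deriv ?_
    have : t * ξ + ((j + 1 : ℕ) : ℝ) * (Real.pi / 2)
        = (t * ξ + j * (Real.pi / 2)) + Real.pi / 2 := by push_cast; ring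
    rw [this, Real.cos_add_pi_div_two]
    ring

lemma iteratedDeriv_sinc (j : ℕ) :
    iteratedDeriv j Real.sinc =
      fun t => ∫ ξ in (0 : ℝ)..1, ξ ^ j * Real.cos (t * ξ + j * (Real.pi / 2)) := by
  induction j with
  | zero =>
    ext t
    by_cases ht : t = 0
    · simp [ht]
    · simp [Real.sinc_of_ne_zero ht, intervalIntegral.integral_comp_mul_left _ ht]
      field_simp
  | succ j ih =>
    rw [iteratedDeriv_succ, ih]
    exact funext fun t => (hasDerivAt_integral_pow_mul_cos j t).deriv

/-- The band is `[0, 1]`, on which `ξ ^ j` and the cosine are bounded by 1. -/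
lemma hasExpDerivBound_sinc : HasExpDerivBound 1 Real.sinc := by
  constructor
  · refine contDiff_of_differentiable_iteratedDeriv fun j _ => ?_
    rw [iteratedDeriv_sinc]
    exact fun t => (hasDerivAt_integral_pow_mul_cos j t).differentiableAt
  · intro j t
    rw [iteratedDeriv_sinc, one_pow, ← Real.norm_eq_abs]
    have := intervalIntegral.norm_integral_le_of_norm_le_const (a := 0) (b := 1) (C := 1)
      (f := fun ξ : ℝ => ξ ^ j * Real.cos (t * ξ + j * (Real.pi / 2))) (fun ξ hξ => ?_)
    · simpa using this
    · rw [Set.uIoc_of_le zero_le_one] at hξ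
      rw [Real.norm_eq_abs, abs_mul, abs_pow, abs_of_pos hξ.1]
      exact mul_le_one₀ (pow_le_one₀ hξ.1.le hξ.2) (abs_nonneg _) (Real.abs_cos_le_one _)

lemma mul_sinc (t : ℝ) : t * Real.sinc t = Real.sin t := by
  by_cases ht : t = 0
  · simp [ht]
  · rw [Real.sinc_of_ne_zero ht]; field_simp

lemma sinc_sq_le (t : ℝ) : Real.sinc t ^ 2 ≤ 2 * (1 + t ^ 2)⁻¹ := by
  have h1 : Real.sinc t ^ 2 ≤ 1 := (sq_le_one_iff_abs_le_one _).2 (Real.abs_sinc_le_one t)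
  have h2 : (t * Real.sinc t) ^ 2 ≤ 1 := by
    rw [mul_sinc]; exact Real.sin_sq_le_one t
  rw [← div_eq_mul_inv, le_div_iff₀ (by positivity)]
  nlinarith

lemma sinc_sq_ge {t c : ℝ} (hc : 0 < c) (h : |t| ≤ c) :
    Real.sin t ^ 2 / c ^ 2 ≤ Real.sinc t ^ 2 := by
  rw [div_le_iff₀ (by positivity), ← mul_sinc, mul_pow, mul_comm]
  exact mul_le_mul_of_nonneg_left (sq_le_sq.2 (by rwa [abs_of_pos hc])) (sq_nonneg _)

/-- A nonnegative integrable function of exponential type that decays no faster than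
`1 / t ^ 2`. -/
noncomputable def sincEnvelope (t : ℝ) : ℝ :=
  2⁻¹ * (Real.sinc t ^ 2 + Real.sinc (t + Real.pi / 2) ^ 2)

lemma hasExpDerivBound_sincEnvelope : HasExpDerivBound 2 sincEnvelope := by
  have h1 := hasExpDerivBound_sinc.mul hasExpDerivBound_sinc
  have h2 := h1.comp_mul_add 1 (Real.pi / 2)
  norm_num at h1 h2
  have := h1.midpoint h2
  simp only [← sq] at this
  exact this

lemma sincEnvelope_nonneg (t : ℝ) : 0 ≤ sincEnvelope t := by
  unfold sincEnvelope; positivity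

lemma continuous_sincEnvelope : Continuous sincEnvelope :=
  hasExpDerivBound_sincEnvelope.contDiff.continuous

lemma integrable_sinc_sq : Integrable (fun t => Real.sinc t ^ 2) := by
  refine (integrable_inv_one_add_sq.const_mul 2).mono'
    (Real.continuous_sinc.pow 2).aestronglyMeasurable (Filter.Eventually.of_forall fun t => ?_)
  rw [Real.norm_eq_abs, abs_of_nonneg (by positivity)]
  exact sinc_sq_le t

lemma integrable_sincEnvelope : Integrable sincEnvelope :=
  (integrable_sinc_sq.add (integrable_sinc_sq.comp_add_right (Real.pi / 2))).const_mul 2⁻¹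

/-- The zeros of sinc² are compensated by the shift by `π / 2`, which turns `sin²` into `cos²`: the
two numerators sum to 1, and both arguments are at most `|t| + 2` in absolute value. -/
lemma le_sincEnvelope (t : ℝ) : 2⁻¹ * ((|t| + 2) ^ 2)⁻¹ ≤ sincEnvelope t := by
  unfold sincEnvelope
  have hc : 0 < |t| + 2 := by positivity
  have h1 := sinc_sq_ge hc (t := t) (by linarith)
  have h2 := sinc_sq_ge hc (t := t + Real.pi / 2) (by
    have := abs_add_le t (Real.pi / 2)
    rw [abs_of_pos (by positivity : (0 : ℝ) < Real.pi / 2)] at this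
    linarith [Real.pi_le_four])
  rw [Real.sin_add_pi_div_two] at h2
  have h3 := Real.sin_sq_add_cos_sq t
  have h4 : Real.sin t ^ 2 / (|t| + 2) ^ 2 + Real.cos t ^ 2 / (|t| + 2) ^ 2
      = ((|t| + 2) ^ 2)⁻¹ := by
    rw [← add_div, h3, one_div]
  gcongr
  linarith

lemma hasExpDerivBound_sinc_pow_four : HasExpDerivBound 4 (fun t => Real.sinc t ^ 4) := by
  have h1 := hasExpDerivBound_sinc.mul hasExpDerivBound_sinc
  have h2 := h1.mul h1
  norm_num at h2
  convert h2 using 2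
  ring

lemma continuous_sinc_pow_four : Continuous (fun t => Real.sinc t ^ 4) :=
  Real.continuous_sinc.pow 4

/-- Cubic decay is all that is needed: it makes the tail integrals quadratic, the order of the lower
bound for `sincEnvelope`. -/
lemma sinc_pow_four_le {t : ℝ} (ht : 0 ≤ t) : Real.sinc t ^ 4 ≤ 50 * (t + 2) ^ (-3 : ℝ) := by
  have h1 := sinc_sq_le t
  have h2 : Real.sinc t ^ 4 ≤ (2 * (1 + t ^ 2)⁻¹) ^ 2 := by
    calc Real.sinc t ^ 4 = (Real.sinc t ^ 2) ^ 2 := by ring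
      _ ≤ _ := by gcongr
  refine h2.trans ?_
  have h3 : (t + 2) ^ (-3 : ℝ) = ((t + 2) ^ 3)⁻¹ := by
    rw [Real.rpow_neg (by positivity)]
    norm_cast
  rw [h3, mul_pow, inv_pow, ← div_eq_mul_inv, ← div_eq_mul_inv,
    div_le_div_iff₀ (by positivity) (by positivity)]
  have h4 : (t + 2) ^ 2 ≤ 5 * (1 + t ^ 2) := by nlinarith [sq_nonneg (2 * t - 1)]
  have h5 : ((t + 2) ^ 2) ^ 2 ≤ (5 * (1 + t ^ 2)) ^ 2 := by gcongr
  have h6 : 2 * (t + 2) ^ 3 ≤ ((t + 2) ^ 2) ^ 2 := by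
    have : 0 ≤ (t + 2) ^ 3 * t := by positivity
    nlinarith
  nlinarith

lemma integrable_sinc_pow_four : Integrable (fun t => Real.sinc t ^ 4) := by
  refine integrable_sinc_sq.mono' continuous_sinc_pow_four.aestronglyMeasurable
    (Filter.Eventually.of_forall fun t => ?_)
  rw [Real.norm_eq_abs, abs_of_nonneg (by positivity)]
  have h1 : Real.sinc t ^ 2 ≤ 1 := (sq_le_one_iff_abs_le_one _).2 (Real.abs_sinc_le_one t)
  nlinarith [sq_nonneg (Real.sinc t)]

lemma integral_sinc_pow_four_pos : 0 < ∫ t, Real.sinc t ^ 4 := by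
  exact integral_pos_of_integrable_nonneg_nonzero (x := 0) continuous_sinc_pow_four
    integrable_sinc_pow_four (fun t => by positivity) (by simp)

lemma integral_Ioi_sinc_pow_four_le {t : ℝ} (ht : 0 ≤ t) :
    ∫ s in Set.Ioi t, Real.sinc s ^ 4 ≤ 25 * ((|t| + 2) ^ 2)⁻¹ := by
  have h0 : ∀ s ∈ Set.Ioi t, HasDerivAt (fun s : ℝ => -(1 / 2) * (s + 2) ^ (-2 : ℝ))
      ((s + 2) ^ (-3 : ℝ)) s := by
    intro s hs
    have hs : 0 < s + 2 := by have : t < s := hs; linarith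
    have := ((hasDerivAt_id s).add_const 2).rpow_const (p := -2) (Or.inl hs.ne')
    refine (this.const_mul (-(1 / 2))).congr_deriv ?_
    norm_num
    ring
  have hlim : Filter.Tendsto (fun s : ℝ => -(1 / 2) * (s + 2) ^ (-2 : ℝ)) Filter.atTop
      (nhds (-(1 / 2) * 0)) :=
    ((tendsto_rpow_neg_atTop (by norm_num : (0 : ℝ) < 2)).comp
      (Filter.tendsto_atTop_add_const_right _ 2 Filter.tendsto_id)).const_mul _
  have hcont : ContinuousWithinAt (fun s : ℝ => -(1 / 2) * (s + 2) ^ (-2 : ℝ)) (Set.Ici t) t :=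
    (continuousAt_const.mul ((continuousAt_id.add continuousAt_const).rpow_const
      (Or.inl (by simp; positivity)))).continuousWithinAt
  have hpos : ∀ s ∈ Set.Ioi t, 0 ≤ (s + 2) ^ (-3 : ℝ) := fun s hs =>
    Real.rpow_nonneg (by have : t < s := hs; linarith) _
  have h1 := integral_Ioi_of_hasDerivAt_of_nonneg hcont h0 hpos hlim
  have h2 := integrableOn_Ioi_deriv_of_nonneg hcont h0 hpos hlim
  calc ∫ s in Set.Ioi t, Real.sinc s ^ 4 ≤ ∫ s in Set.Ioi t, 50 * (s + 2) ^ (-3 : ℝ) := by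
        refine setIntegral_mono_on integrable_sinc_pow_four.integrableOn (h2.const_mul 50)
          measurableSet_Ioi fun s hs => sinc_pow_four_le ?_
        have : t < s := hs
        linarith
    _ = 25 * ((|t| + 2) ^ 2)⁻¹ := by
        rw [integral_const_mul, h1, abs_of_nonneg ht]
        have : (t + 2) ^ (-2 : ℝ) = ((t + 2) ^ 2)⁻¹ := by
          rw [Real.rpow_neg (by positivity)]
          norm_cast
        rw [this]
        ring

lemma integral_Iic_sinc_pow_four_le {t : ℝ} (ht : t ≤ 0) :
    ∫ s in Set.Iic t, Real.sinc s ^ 4 ≤ 25 * ((|t| + 2) ^ 2)⁻¹ := by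
  have h := integral_comp_neg_Iic t (fun s => Real.sinc s ^ 4)
  simp only [Real.sinc_neg] at h
  rw [h]
  simpa using integral_Ioi_sinc_pow_four_le (neg_nonneg.2 ht)

/-! ### A smooth step of exponential type -/

/-- A smooth step function of exponential type. -/
noncomputable def smoothStep (t : ℝ) : ℝ :=
  (∫ s, Real.sinc s ^ 4)⁻¹ * ∫ s in Set.Iic t, Real.sinc s ^ 4

lemma smoothStep_nonneg (t : ℝ) : 0 ≤ smoothStep t :=
  mul_nonneg (inv_nonneg.2 integral_sinc_pow_four_pos.le) (integral_nonneg fun s => by positivity)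

lemma one_sub_smoothStep (t : ℝ) :
    1 - smoothStep t = (∫ s, Real.sinc s ^ 4)⁻¹ * ∫ s in Set.Ioi t, Real.sinc s ^ 4 := by
  have h := intervalIntegral.integral_Iic_add_Ioi (b := t)
    integrable_sinc_pow_four.integrableOn integrable_sinc_pow_four.integrableOn
  unfold smoothStep
  have h0 := integral_sinc_pow_four_pos.ne'
  rw [eq_comm, eq_sub_iff_add_eq, add_comm, ← mul_add, h, inv_mul_cancel₀ h0]

lemma smoothStep_le_one (t : ℝ) : smoothStep t ≤ 1 := by
  rw [← sub_nonneg, one_sub_smoothStep]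
  exact mul_nonneg (inv_nonneg.2 integral_sinc_pow_four_pos.le)
    (integral_nonneg fun s => by positivity)

lemma hasDerivAt_smoothStep (t : ℝ) :
    HasDerivAt smoothStep ((∫ s, Real.sinc s ^ 4)⁻¹ * Real.sinc t ^ 4) t := by
  have h : smoothStep = fun t => (∫ s, Real.sinc s ^ 4)⁻¹ *
      ((∫ s in Set.Iic 0, Real.sinc s ^ 4) + ∫ s in (0 : ℝ)..t, Real.sinc s ^ 4) := by
    ext t
    rw [← intervalIntegral.integral_Iic_sub_Iic integrable_sinc_pow_four.integrableOn
      integrable_sinc_pow_four.integrableOn, add_sub_cancel, smoothStep]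
  rw [h]
  exact ((continuous_sinc_pow_four.integral_hasStrictDerivAt 0 t).hasDerivAt.const_add _).const_mul _

/-- The exponential type of the functions used for smoothing. -/
noncomputable def smoothingType : ℝ := max 4 (∫ s, Real.sinc s ^ 4)⁻¹

lemma smoothingType_pos : 0 < smoothingType := lt_max_of_lt_left (by norm_num)

/-- The type must dominate both the type 4 of sinc⁴ and the normalizing factor in front of the
derivative, hence the maximum in `smoothingType`. -/
lemma hasExpDerivBound_smoothStep : HasExpDerivBound smoothingType smoothStep :=
  (hasExpDerivBound_sinc_pow_four.mono (le_max_left _ _)).of_deriv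
    (inv_nonneg.2 integral_sinc_pow_four_pos.le) hasDerivAt_smoothStep
    (fun t => abs_le.2 ⟨by linarith [smoothStep_nonneg t], smoothStep_le_one t⟩)
    (le_max_right _ _)

/-- The constant in the comparison of `smoothStep` with the step function. -/
noncomputable def smoothStepError : ℝ := 50 * (∫ s, Real.sinc s ^ 4)⁻¹

lemma smoothStepError_pos : 0 < smoothStepError :=
  mul_pos (by norm_num) (inv_pos.2 integral_sinc_pow_four_pos)

/-- The error is a tail of the integral of sinc⁴, on the right if `0 < t` and on the left otherwise.
Bounding it by a function that is itself of exponential type is what later allows it to be averaged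
under `Y`. -/
lemma abs_smoothStep_sub_le (t : ℝ) :
    |smoothStep t - if 0 < t then 1 else 0| ≤ smoothStepError * sincEnvelope t := by
  have h0 := inv_nonneg.2 integral_sinc_pow_four_pos.le
  have h1 : |smoothStep t - if 0 < t then 1 else 0|
      ≤ (∫ s, Real.sinc s ^ 4)⁻¹ * (25 * ((|t| + 2) ^ 2)⁻¹) := by
    split_ifs with ht
    · rw [abs_sub_comm, abs_of_nonneg (sub_nonneg.2 (smoothStep_le_one t)), one_sub_smoothStep]
      exact mul_le_mul_of_nonneg_left (integral_Ioi_sinc_pow_four_le ht.le) h0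
    · rw [sub_zero, abs_of_nonneg (smoothStep_nonneg t), smoothStep]
      exact mul_le_mul_of_nonneg_left (integral_Iic_sinc_pow_four_le (not_lt.1 ht)) h0
  refine h1.trans ?_
  have h2 := mul_le_mul_of_nonneg_left (le_sincEnvelope t) h0
  rw [smoothStepError]
  linarith

/-! ### Matching moments under `k`-wise independence -/

section Moments

variable {Ω Ω' : Type*} [MeasurableSpace Ω] [MeasurableSpace Ω'] {n k : ℕ}
  {P : Measure Ω} {P' : Measure Ω'}
  {X : Ω → EuclideanSpace ℝ (Fin n)} {Y : Ω' → EuclideanSpace ℝ (Fin n)}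

lemma IsIndepStdGaussianVector.isKWise (hX : IsIndepStdGaussianVector X P) (k : ℕ) :
    IsKWiseIndepStdGaussianVector k X P :=
  ⟨hX.hasLaw, fun _ _ => hX.indep.precomp Subtype.val_injective⟩

lemma IsKWiseIndepStdGaussianVector.mono {l : ℕ} (hY : IsKWiseIndepStdGaussianVector k Y P')
    (h : l ≤ k) : IsKWiseIndepStdGaussianVector l Y P' :=
  ⟨hY.hasLaw, fun s hs => hY.indep s (hs.trans h)⟩

lemma IsKWiseIndepStdGaussianVector.aemeasurable (hY : IsKWiseIndepStdGaussianVector k Y P') :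
    AEMeasurable Y P' := by
  have h : AEMeasurable (fun ω i => Y ω i) P' := aemeasurable_pi_lambda _ fun i =>
    (hY.hasLaw i).aemeasurable
  exact (WithLp.measurable_toLp 2 (Fin n → ℝ)).comp_aemeasurable h

lemma IsIndepStdGaussianVector.hasLaw_stdGaussian [IsProbabilityMeasure P]
    (hX : IsIndepStdGaussianVector X P) :
    HasLaw X (stdGaussian (EuclideanSpace ℝ (Fin n))) P := by
  refine ⟨(hX.isKWise 0).aemeasurable, ?_⟩
  have h1 := (iIndepFun_iff_map_fun_eq_pi_map fun i => (hX.hasLaw i).aemeasurable).1 hX.indep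
  simp only [(hX.hasLaw _).map_eq] at h1
  rw [← map_pi_eq_stdGaussian, ← h1, AEMeasurable.map_map_of_aemeasurable]
  · rfl
  · exact (WithLp.measurable_toLp 2 (Fin n → ℝ)).aemeasurable
  · exact aemeasurable_pi_lambda _ fun i => (hX.hasLaw i).aemeasurable

/-- The canonical model: everything proved for `Y` then also applies to `stdGaussian`. -/
lemma isIndepStdGaussianVector_id :
    IsIndepStdGaussianVector (fun x => x) (stdGaussian (EuclideanSpace ℝ (Fin n))) := by
  have h1 : (stdGaussian (EuclideanSpace ℝ (Fin n))).map (fun x i => x i)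
      = Measure.pi fun _ => gaussianReal 0 1 := by
    rw [← map_pi_eq_stdGaussian, Measure.map_map (by fun_prop) (by fun_prop)]
    exact Measure.map_id
  have h2 : ∀ i, HasLaw (fun x : EuclideanSpace ℝ (Fin n) => x i) (gaussianReal 0 1)
      (stdGaussian (EuclideanSpace ℝ (Fin n))) := by
    intro i
    refine ⟨by fun_prop, ?_⟩
    have := congrArg (Measure.map (Function.eval i)) h1
    rw [Measure.map_map (by fun_prop) (by fun_prop),
      (measurePreserving_eval (fun _ : Fin n => gaussianReal 0 1) i).map_eq] at this
    exact this
  refine ⟨h2, (iIndepFun_iff_map_fun_eq_pi_map fun i => (h2 i).aemeasurable).2 ?_⟩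
  rw [h1]
  congr 1
  ext1 i
  exact (h2 i).map_eq.symm

lemma IsKWiseIndepStdGaussianVector.memLp (hY : IsKWiseIndepStdGaussianVector k Y P') (i : Fin n)
    (p : NNReal) : MemLp (fun ω => Y ω i) p P' := by
  have := memLp_id_gaussianReal (μ := 0) (v := 1) p
  rw [← (hY.hasLaw i).map_eq, memLp_map_measure_iff (by fun_prop) (hY.hasLaw i).aemeasurable]
    at this
  exact this

/-- No independence is involved: the product is at most `(∑ |Y (r l)|) ^ j`, and each coordinate has
all moments. -/
lemma IsKWiseIndepStdGaussianVector.integrable_prod [IsProbabilityMeasure P']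
    (hY : IsKWiseIndepStdGaussianVector k Y P') {j : ℕ} (r : Fin j → Fin n) :
    Integrable (fun ω => ∏ l, Y ω (r l)) P' := by
  have h1 : MemLp (fun ω => ∑ l, |Y ω (r l)|) (j : NNReal) P' :=
    memLp_finsetSum _ fun l _ => (hY.memLp (r l) j).abs
  refine Integrable.mono' (h1.integrable_norm_pow' ) ?_ ?_
  · exact (Finset.aemeasurable_fun_prod _ fun l _ =>
      (hY.hasLaw (r l)).aemeasurable).aestronglyMeasurable
  · refine Filter.Eventually.of_forall fun ω => ?_
    simp only [Real.norm_eq_abs, Finset.abs_prod]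
    calc ∏ l, |Y ω (r l)| ≤ ∏ l : Fin j, ∑ l, |Y ω (r l)| :=
          Finset.prod_le_prod (fun _ _ => abs_nonneg _) fun l _ =>
            Finset.single_le_sum (f := fun l => |Y ω (r l)|) (fun _ _ => abs_nonneg _)
              (Finset.mem_univ l)
      _ ≤ _ := by
        rw [Finset.prod_const, Finset.card_univ, Fintype.card_fin]
        simp [abs_of_nonneg (Finset.sum_nonneg fun l _ => abs_nonneg (Y ω (r l)))]

lemma IsKWiseIndepStdGaussianVector.map_restrict [IsProbabilityMeasure P']
    (hY : IsKWiseIndepStdGaussianVector k Y P') {s : Finset (Fin n)} (hs : s.card ≤ k) :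
    P'.map (fun ω (i : s) => Y ω i) = Measure.pi fun _ => gaussianReal 0 1 := by
  have h1 := (iIndepFun_iff_map_fun_eq_pi_map fun i : s => (hY.hasLaw i).aemeasurable).1
    (hY.indep s hs)
  simpa only [(hY.hasLaw _).map_eq] using h1

/-- A monomial of degree `j` sees at most `j` distinct coordinates, which are jointly independent.
The right side does not mention `Y`, so any two such vectors give the same value. -/
lemma IsKWiseIndepStdGaussianVector.integral_prod [IsProbabilityMeasure P']
    (hY : IsKWiseIndepStdGaussianVector k Y P') {j : ℕ} (hj : j ≤ k) (r : Fin j → Fin n) :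
    ∫ ω, ∏ l, Y ω (r l) ∂P' = ∫ z : {i // i ∈ Finset.univ.image r} → ℝ,
      ∏ l, z ⟨r l, Finset.mem_image_of_mem r (Finset.mem_univ l)⟩
        ∂(Measure.pi fun _ => gaussianReal 0 1) := by
  have hs : (Finset.univ.image r).card ≤ k :=
    (Finset.card_image_le.trans (by simp)).trans hj
  rw [← hY.map_restrict hs, integral_map]
  · exact aemeasurable_pi_lambda _ fun i => (hY.hasLaw i).aemeasurable
  · exact (by fun_prop : Measurable _).aestronglyMeasurable

lemma MultilinearMap.map_diag_eq_sum {j : ℕ}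
    (f : MultilinearMap ℝ (fun _ : Fin j => EuclideanSpace ℝ (Fin n)) ℝ)
    (x : EuclideanSpace ℝ (Fin n)) :
    f (fun _ => x) = ∑ r : Fin j → Fin n,
      (∏ l, x (r l)) * f fun l => EuclideanSpace.single (r l) 1 := by
  have hx : x = ∑ i, x i • EuclideanSpace.single i (1 : ℝ) := by
    ext j
    simp [Finset.sum_apply, Pi.single_apply]
  conv_lhs => rw [hx]
  rw [f.map_sum]
  refine Finset.sum_congr rfl fun r _ => ?_
  rw [f.map_smul_univ, smul_eq_mul]

lemma IsKWiseIndepStdGaussianVector.integrable_multilinear [IsProbabilityMeasure P']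
    (hY : IsKWiseIndepStdGaussianVector k Y P') {j : ℕ}
    (f : MultilinearMap ℝ (fun _ : Fin j => EuclideanSpace ℝ (Fin n)) ℝ) :
    Integrable (fun ω => f fun _ => Y ω) P' := by
  simp only [f.map_diag_eq_sum]
  exact integrable_finsetSum _ fun r _ => (hY.integrable_prod r).mul_const _

lemma IsKWiseIndepStdGaussianVector.integral_multilinear [IsProbabilityMeasure P']
    (hY : IsKWiseIndepStdGaussianVector k Y P') {j : ℕ} (hj : j ≤ k)
    (f : MultilinearMap ℝ (fun _ : Fin j => EuclideanSpace ℝ (Fin n)) ℝ) :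
    ∫ ω, f (fun _ => Y ω) ∂P'
      = ∫ x, f (fun _ => x) ∂(stdGaussian (EuclideanSpace ℝ (Fin n))) := by
  have hX := (isIndepStdGaussianVector_id (n := n)).isKWise k
  simp only [f.map_diag_eq_sum]
  rw [integral_finsetSum _ fun r _ => (hY.integrable_prod r).mul_const _,
    integral_finsetSum _ fun r _ => (hX.integrable_prod r).mul_const _]
  refine Finset.sum_congr rfl fun r _ => ?_
  rw [integral_mul_const, integral_mul_const, hY.integral_prod hj, hX.integral_prod hj]

/-- The multilinear map `(x₁, …, xⱼ) ↦ ∏ ⟨a, xₗ⟩`. -/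
noncomputable def innerProdMultilinear (a : EuclideanSpace ℝ (Fin n)) (j : ℕ) :
    MultilinearMap ℝ (fun _ : Fin j => EuclideanSpace ℝ (Fin n)) ℝ :=
  (MultilinearMap.mkPiAlgebra ℝ (Fin j) ℝ).compLinearMap
    fun _ => (innerSL ℝ a : EuclideanSpace ℝ (Fin n) →ₗ[ℝ] ℝ)

lemma innerProdMultilinear_diag (a x : EuclideanSpace ℝ (Fin n)) (j : ℕ) :
    innerProdMultilinear a j (fun _ => x) = (inner ℝ a x) ^ j := by
  simp [innerProdMultilinear]

lemma IsKWiseIndepStdGaussianVector.integrable_inner_pow [IsProbabilityMeasure P']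
    (hY : IsKWiseIndepStdGaussianVector k Y P') (a : EuclideanSpace ℝ (Fin n)) (j : ℕ) :
    Integrable (fun ω => (inner ℝ a (Y ω)) ^ j) P' := by
  simpa only [innerProdMultilinear_diag] using hY.integrable_multilinear (innerProdMultilinear a j)

lemma IsKWiseIndepStdGaussianVector.integral_inner_pow [IsProbabilityMeasure P']
    (hY : IsKWiseIndepStdGaussianVector k Y P') (a : EuclideanSpace ℝ (Fin n)) {j : ℕ}
    (hj : j ≤ k) :
    ∫ ω, (inner ℝ a (Y ω)) ^ j ∂P'
      = ∫ x, (inner ℝ a x) ^ j ∂(stdGaussian (EuclideanSpace ℝ (Fin n))) := by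
  simpa only [innerProdMultilinear_diag] using
    hY.integral_multilinear hj (innerProdMultilinear a j)

lemma hasLaw_inner_stdGaussian {a : EuclideanSpace ℝ (Fin n)} (ha : ‖a‖ = 1) :
    HasLaw (fun x => inner ℝ a x) (gaussianReal 0 1)
      (stdGaussian (EuclideanSpace ℝ (Fin n))) := by
  refine ⟨by fun_prop, ?_⟩
  have h := IsGaussian.map_eq_gaussianReal (μ := stdGaussian (EuclideanSpace ℝ (Fin n)))
    (innerSL ℝ a)
  rw [integral_strongDual_stdGaussian, variance_dual_stdGaussian, innerSL_apply_norm, ha] at h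
  simpa using h

/-- One term of the exponential series gives `|c z| ^ j / j! ≤ e^(c z) + e^(-c z)`, whose mean is
known. The free parameter `c` is optimized later. -/
lemma integral_pow_gaussianReal_le {j : ℕ} (hj : Even j) {c : ℝ} (hc : 0 < c) :
    c ^ j * ∫ z, z ^ j ∂(gaussianReal 0 1) ≤ j.factorial * (2 * Real.exp (c ^ 2 / 2)) := by
  have h1 := integrable_exp_mul_gaussianReal (μ := 0) (v := 1) c
  have h2 := integrable_exp_mul_gaussianReal (μ := 0) (v := 1) (-c)
  have m1 := congrFun (mgf_fun_id_gaussianReal (μ := 0) (v := 1)) c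
  have m2 := congrFun (mgf_fun_id_gaussianReal (μ := 0) (v := 1)) (-c)
  simp only [mgf] at m1 m2
  calc c ^ j * ∫ z, z ^ j ∂(gaussianReal 0 1)
      = ∫ z, c ^ j * z ^ j ∂(gaussianReal 0 1) := (integral_const_mul _ _).symm
    _ ≤ ∫ z, j.factorial * (Real.exp (c * z) + Real.exp (-c * z)) ∂(gaussianReal 0 1) := by
        refine integral_mono_of_nonneg ?_ ((h1.add h2).const_mul _) ?_
        · exact Filter.Eventually.of_forall fun z =>
            mul_nonneg (by positivity) (hj.pow_nonneg z)
        · refine Filter.Eventually.of_forall fun z => ?_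
          have h3 := Real.pow_div_factorial_le_exp |c * z| (abs_nonneg _) j
          rw [div_le_iff₀' (by positivity), hj.pow_abs, mul_pow] at h3
          refine h3.trans (mul_le_mul_of_nonneg_left ?_ (by positivity))
          rcases abs_cases (c * z) with ⟨h, _⟩ | ⟨h, _⟩ <;> rw [h]
          · linarith [Real.exp_pos (-c * z)]
          · rw [← neg_mul]
            linarith [Real.exp_pos (c * z)]
    _ = _ := by
        rw [integral_const_mul, integral_add h1 h2, m1, m2]
        simp only [zero_mul, zero_add, NNReal.coe_one, one_mul, neg_sq, two_mul]

lemma IsKWiseIndepStdGaussianVector.integral_inner_pow_le [IsProbabilityMeasure P']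
    (hY : IsKWiseIndepStdGaussianVector k Y P') {a : EuclideanSpace ℝ (Fin n)} (ha : ‖a‖ = 1)
    {j : ℕ} (hj : j ≤ k) (hje : Even j) {c : ℝ} (hc : 0 < c) :
    c ^ j * ∫ ω, (inner ℝ a (Y ω)) ^ j ∂P' ≤ j.factorial * (2 * Real.exp (c ^ 2 / 2)) := by
  rw [hY.integral_inner_pow a hj]
  have h := (hasLaw_inner_stdGaussian ha).integral_comp (f := fun z : ℝ => z ^ j)
    (by fun_prop)
  simp only [Function.comp_def] at h
  rw [h]
  exact integral_pow_gaussianReal_le hje hc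

end Moments

/-! ### Taylor expansion along rays -/

section Taylor

variable {E : Type*} [NormedAddCommGroup E] [NormedSpace ℝ E]

lemma iteratedDeriv_comp_smul_const {H : E → ℝ} (hH : ContDiff ℝ (⊤ : ℕ∞) H) (x : E) (j : ℕ) :
    iteratedDeriv j (fun s : ℝ => H (s • x)) 0 = iteratedFDeriv ℝ j H 0 (fun _ => x) := by
  have h := (ContinuousLinearMap.toSpanSingleton ℝ x).iteratedFDeriv_comp_right (n := (j : ℕ∞))
    (f := H) (hH.of_le (by exact_mod_cast le_top)) 0 (i := j) le_rfl
  have h2 : (fun s : ℝ => H (s • x)) = H ∘ (ContinuousLinearMap.toSpanSingleton ℝ x) := by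
    ext s; simp
  rw [iteratedDeriv_eq_iteratedFDeriv, h2, h]
  simp

/-- Taylor expansion of a smooth function at the origin, with a bound on the remainder that only
depends on the derivatives along the ray through `x`. -/
lemma abs_sub_taylor_le {H : E → ℝ} (hH : ContDiff ℝ (⊤ : ℕ∞) H) (x : E) (k : ℕ) {M : ℝ}
    (hM : ∀ s : ℝ, |iteratedDeriv (k + 1) (fun s : ℝ => H (s • x)) s| ≤ M) :
    |H x - ∑ j ∈ Finset.range (k + 1),
      (j.factorial : ℝ)⁻¹ * iteratedFDeriv ℝ j H 0 (fun _ => x)| ≤ M / (k + 1).factorial := by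
  have hf : ContDiff ℝ (⊤ : ℕ∞) (fun s : ℝ => H (s • x)) := hH.comp (by fun_prop)
  have hle : ∀ j : ℕ, ContDiff ℝ j (fun s : ℝ => H (s • x)) := fun j =>
    hf.of_le (by exact_mod_cast le_top)
  obtain ⟨s, -, hs⟩ := taylor_mean_remainder_lagrange_iteratedDeriv (n := k) (zero_ne_one' ℝ)
    (by exact_mod_cast (hle (k + 1)).contDiffOn)
  have h : taylorWithinEval (fun s : ℝ => H (s • x)) k (Set.uIcc 0 1) 0 1
      = ∑ j ∈ Finset.range (k + 1),
        (j.factorial : ℝ)⁻¹ * iteratedFDeriv ℝ j H 0 (fun _ => x) := by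
    rw [taylor_within_apply]
    refine Finset.sum_congr rfl fun j _ => ?_
    rw [iteratedDerivWithin_eq_iteratedDeriv (uniqueDiffOn_uIcc (zero_ne_one' ℝ))
      (hle j).contDiffAt Set.left_mem_uIcc, iteratedDeriv_comp_smul_const hH]
    simp
  rw [h, one_smul] at hs
  rw [hs, sub_zero, one_pow, mul_one, abs_div, Nat.abs_cast]
  gcongr
  exact hM s

end Taylor

/-! ### Fooling smooth functions of exponential type -/

section Fooling

variable {Ω' : Type*} [MeasurableSpace Ω'] {n k m : ℕ} {P' : Measure Ω'} [IsProbabilityMeasure P']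
  {Y : Ω' → EuclideanSpace ℝ (Fin n)}

/-- The degree `k` Taylor polynomial of `H` at the origin. -/
noncomputable def taylorPoly (H : EuclideanSpace ℝ (Fin n) → ℝ) (k : ℕ)
    (x : EuclideanSpace ℝ (Fin n)) : ℝ :=
  ∑ j ∈ Finset.range (k + 1),
    (j.factorial : ℝ)⁻¹ * (iteratedFDeriv ℝ j H 0).toMultilinearMap (fun _ => x)

lemma IsKWiseIndepStdGaussianVector.integrable_taylorPoly
    (hY : IsKWiseIndepStdGaussianVector k Y P') (H : EuclideanSpace ℝ (Fin n) → ℝ) (l : ℕ) :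
    Integrable (fun ω => taylorPoly H l (Y ω)) P' :=
  integrable_finsetSum _ fun j _ =>
    (hY.integrable_multilinear (iteratedFDeriv ℝ j H 0).toMultilinearMap).const_mul _

lemma IsKWiseIndepStdGaussianVector.integral_taylorPoly
    (hY : IsKWiseIndepStdGaussianVector k Y P') (H : EuclideanSpace ℝ (Fin n) → ℝ) {l : ℕ}
    (hl : l ≤ k) :
    ∫ ω, taylorPoly H l (Y ω) ∂P'
      = ∫ x, taylorPoly H l x ∂(stdGaussian (EuclideanSpace ℝ (Fin n))) := by
  have hX := (isIndepStdGaussianVector_id (n := n)).isKWise k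
  unfold taylorPoly
  rw [integral_finsetSum _ fun j _ => (hY.integrable_multilinear
      (iteratedFDeriv ℝ j H 0).toMultilinearMap).const_mul _,
    integral_finsetSum _ fun j _ => (hX.integrable_multilinear
      (iteratedFDeriv ℝ j H 0).toMultilinearMap).const_mul _]
  refine Finset.sum_congr rfl fun j hj => ?_
  rw [integral_const_mul, integral_const_mul]
  congr 1
  exact hY.integral_multilinear ((Nat.lt_succ_iff.1 (Finset.mem_range.1 hj)).trans hl)
    (iteratedFDeriv ℝ j H 0).toMultilinearMap

lemma IsKWiseIndepStdGaussianVector.integrable_of_bounded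
    (hY : IsKWiseIndepStdGaussianVector k Y P') {H : EuclideanSpace ℝ (Fin n) → ℝ}
    (hH : Measurable H) (h1 : ∀ x, |H x| ≤ 1) : Integrable (fun ω => H (Y ω)) P' :=
  Integrable.of_bound (hH.comp_aemeasurable hY.aemeasurable).aestronglyMeasurable 1
    (Filter.Eventually.of_forall fun _ => h1 _)

lemma IsKWiseIndepStdGaussianVector.integrable_sum_abs_inner_pow
    (hY : IsKWiseIndepStdGaussianVector k Y P') (a : Fin m → EuclideanSpace ℝ (Fin n)) {j : ℕ}
    (hje : Even j) : Integrable (fun ω => ∑ i, |inner ℝ (a i) (Y ω)| ^ j) P' := by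
  simp only [hje.pow_abs]
  exact integrable_finsetSum _ fun i _ => hY.integrable_inner_pow (a i) j

/-- Put `j = l + 1`. The Taylor remainder, the power mean inequality and the moment bound give at
most `2 (L m / c) ^ j e^(c² / 2)`. With `c = √j` this is at most `2 e^(-3j/2) e^(j/2) = 2 e^(-j)`.
Evenness of `j` makes absolute moments polynomial, so that `Y` shares them with the Gaussian. -/
lemma IsKWiseIndepStdGaussianVector.integral_abs_sub_taylorPoly_le
    (hY : IsKWiseIndepStdGaussianVector k Y P') {a : Fin m → EuclideanSpace ℝ (Fin n)}
    (ha : ∀ i, ‖a i‖ = 1) {H : EuclideanSpace ℝ (Fin n) → ℝ} (hH : ContDiff ℝ (⊤ : ℕ∞) H)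
    {L : ℝ} (hL : 0 ≤ L) {l : ℕ} (hl : l + 1 ≤ k) (hle : Even (l + 1))
    (hLm : L * m ≤ √(l + 1 : ℕ) * Real.exp (-(3 / 2)))
    (hb : ∀ x s, |iteratedDeriv (l + 1) (fun s : ℝ => H (s • x)) s|
      ≤ (L * ∑ i, |inner ℝ (a i) x|) ^ (l + 1)) :
    ∫ ω, |H (Y ω) - taylorPoly H l (Y ω)| ∂P' ≤ 2 * Real.exp (-(l + 1 : ℕ)) := by
  -- The minimizer of `e^(c² / 2) / c ^ (l + 1)`.
  set c := √(l + 1 : ℕ) with hc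
  have hc0 : 0 < c := Real.sqrt_pos.2 (by positivity)
  have hcsq : c ^ 2 = (l + 1 : ℕ) := Real.sq_sqrt (by positivity)
  have hi := hY.integrable_sum_abs_inner_pow a hle
  have h1 : ∀ x, |H x - taylorPoly H l x|
      ≤ L ^ (l + 1) * m ^ l / (l + 1).factorial * ∑ i, |inner ℝ (a i) x| ^ (l + 1) := by
    intro x
    refine (abs_sub_taylor_le hH x l (hb x)).trans ?_
    have := pow_sum_le_card_mul_sum_pow (s := Finset.univ) (f := fun i => |inner ℝ (a i) x|)
      (fun i _ => abs_nonneg _) l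
    simp only [Finset.card_univ, Fintype.card_fin] at this
    rw [mul_pow, div_mul_eq_mul_div, mul_assoc]
    gcongr
  have h2 : c ^ (l + 1) * ∫ ω, ∑ i, |inner ℝ (a i) (Y ω)| ^ (l + 1) ∂P'
      ≤ m * ((l + 1).factorial * (2 * Real.exp (c ^ 2 / 2))) := by
    simp only [hle.pow_abs]
    rw [integral_finsetSum _ fun i _ => hY.integrable_inner_pow (a i) _, Finset.mul_sum]
    refine (Finset.sum_le_sum fun i _ =>
      hY.integral_inner_pow_le (ha i) hl hle hc0).trans_eq ?_
    simp
  have hexp : (Real.exp (-(3 / 2))) ^ (l + 1) * Real.exp (c ^ 2 / 2)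
      = Real.exp (-(l + 1 : ℕ)) := by
    rw [← Real.exp_nat_mul, ← Real.exp_add, hcsq]
    congr 1
    ring
  have hI : 0 ≤ ∫ ω, ∑ i, |inner ℝ (a i) (Y ω)| ^ (l + 1) ∂P' :=
    integral_nonneg fun ω => Finset.sum_nonneg fun i _ => by positivity
  calc ∫ ω, |H (Y ω) - taylorPoly H l (Y ω)| ∂P'
      ≤ ∫ ω, L ^ (l + 1) * m ^ l / (l + 1).factorial
          * ∑ i, |inner ℝ (a i) (Y ω)| ^ (l + 1) ∂P' :=
        integral_mono_of_nonneg (Filter.Eventually.of_forall fun _ => abs_nonneg _)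
          (hi.const_mul _) (Filter.Eventually.of_forall fun ω => h1 (Y ω))
    _ = L ^ (l + 1) * m ^ l / (l + 1).factorial
          * ∫ ω, ∑ i, |inner ℝ (a i) (Y ω)| ^ (l + 1) ∂P' := integral_const_mul _ _
    _ ≤ L ^ (l + 1) * m ^ l / (l + 1).factorial
          * (m * ((l + 1).factorial * (2 * Real.exp (c ^ 2 / 2))) / c ^ (l + 1)) := by
        gcongr
        rwa [le_div_iff₀' (by positivity)]
    _ = (L * m) ^ (l + 1) * (2 * Real.exp (c ^ 2 / 2)) / c ^ (l + 1) := by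
        have : ((l + 1).factorial : ℝ) ≠ 0 := by positivity
        field_simp
        ring
    _ ≤ (c * Real.exp (-(3 / 2))) ^ (l + 1) * (2 * Real.exp (c ^ 2 / 2)) / c ^ (l + 1) := by
        gcongr
    _ = 2 * Real.exp (-(l + 1 : ℕ)) := by
        rw [← hexp, mul_pow]
        field_simp

/-- Smooth bounded functions whose derivatives along rays grow slowly are fooled. -/
lemma IsKWiseIndepStdGaussianVector.abs_integral_sub_le
    (hY : IsKWiseIndepStdGaussianVector k Y P') {a : Fin m → EuclideanSpace ℝ (Fin n)}
    (ha : ∀ i, ‖a i‖ = 1) {H : EuclideanSpace ℝ (Fin n) → ℝ} (hH : ContDiff ℝ (⊤ : ℕ∞) H)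
    (hH1 : ∀ x, |H x| ≤ 1)
    {L : ℝ} (hL : 0 ≤ L) {l : ℕ} (hl : l + 1 ≤ k) (hle : Even (l + 1))
    (hLm : L * m ≤ √(l + 1 : ℕ) * Real.exp (-(3 / 2)))
    (hb : ∀ x s, |iteratedDeriv (l + 1) (fun s : ℝ => H (s • x)) s|
      ≤ (L * ∑ i, |inner ℝ (a i) x|) ^ (l + 1)) :
    |∫ ω, H (Y ω) ∂P' - ∫ x, H x ∂(stdGaussian (EuclideanSpace ℝ (Fin n)))|
      ≤ 4 * Real.exp (-(l + 1 : ℕ)) := by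
  have hX := (isIndepStdGaussianVector_id (n := n)).isKWise k
  -- Both means are within `2 e^(-(l + 1))` of the mean of the Taylor polynomial, which is common to
  -- the two laws.
  have e1 := hY.integral_abs_sub_taylorPoly_le ha hH hL hl hle hLm hb
  have e2 := hX.integral_abs_sub_taylorPoly_le ha hH hL hl hle hLm hb
  have i1 := abs_integral_le_integral_abs (μ := P') (f := fun ω => H (Y ω) - taylorPoly H l (Y ω))
  have i2 := abs_integral_le_integral_abs (μ := stdGaussian (EuclideanSpace ℝ (Fin n)))
    (f := fun x => H x - taylorPoly H l x)
  rw [integral_sub (hY.integrable_of_bounded hH.continuous.measurable hH1)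
    (hY.integrable_taylorPoly H l), hY.integral_taylorPoly H (by lia)] at i1
  rw [integral_sub (hX.integrable_of_bounded hH.continuous.measurable hH1)
    (hX.integrable_taylorPoly H l)] at i2
  have h3 := abs_le.1 (i1.trans e1)
  have h4 := abs_le.1 (i2.trans e2)
  rw [abs_le]
  constructor <;> linarith

end Fooling

/-! ### Fooling intersections of halfspaces -/

lemma abs_prod_sub_prod_le {ι : Type*} (s : Finset ι) {u v : ι → ℝ}
    (hu : ∀ i, |u i| ≤ 1) (hv : ∀ i, |v i| ≤ 1) :
    |∏ i ∈ s, u i - ∏ i ∈ s, v i| ≤ ∑ i ∈ s, |u i - v i| := by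
  classical
  induction s using Finset.induction_on with
  | empty => simp
  | insert i s hi ih =>
    rw [Finset.prod_insert hi, Finset.prod_insert hi, Finset.sum_insert hi]
    have hp : |∏ i ∈ s, u i| ≤ 1 := by
      rw [Finset.abs_prod]
      exact Finset.prod_le_one (fun _ _ => abs_nonneg _) fun i _ => hu i
    calc |u i * ∏ i ∈ s, u i - v i * ∏ i ∈ s, v i|
        = |(u i - v i) * ∏ i ∈ s, u i + v i * (∏ i ∈ s, u i - ∏ i ∈ s, v i)| := by ring_nf
      _ ≤ |u i - v i| * |∏ i ∈ s, u i| + |v i| * |∏ i ∈ s, u i - ∏ i ∈ s, v i| := by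
        rw [← abs_mul, ← abs_mul]; exact abs_add_le _ _
      _ ≤ |u i - v i| * 1 + 1 * ∑ i ∈ s, |u i - v i| := by
        gcongr
        exact hv i
      _ = _ := by ring

/-- Anticoncentration: the Gaussian density is at most 1, and an affine substitution evaluates the
remaining Lebesgue integral. -/
lemma integral_gaussianReal_comp_affine_le {f : ℝ → ℝ} (hf : ∀ t, 0 ≤ f t)
    (hfi : Integrable f) {T : ℝ} (hT : 0 < T) (θ : ℝ) :
    ∫ z, f (T * (z - θ)) ∂(gaussianReal 0 1) ≤ (∫ t, f t) / T := by
  have h1 : Integrable (fun z => f (T * (z - θ))) :=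
    (hfi.comp_mul_left' hT.ne').comp_sub_right θ
  have hpdf : ∀ z, gaussianPDFReal 0 1 z ≤ 1 := by
    intro z
    rw [gaussianPDFReal_def]
    have h2 : (√(2 * Real.pi * (1 : NNReal)))⁻¹ ≤ 1 := by
      refine inv_le_one_of_one_le₀ (Real.one_le_sqrt.2 ?_)
      simp only [NNReal.coe_one, mul_one]
      linarith [Real.two_le_pi]
    have h3 : Real.exp (-(z - 0) ^ 2 / (2 * (1 : NNReal))) ≤ 1 := by
      rw [Real.exp_le_one_iff]
      simp only [NNReal.coe_one]
      nlinarith [sq_nonneg (z - 0)]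
    exact mul_le_one₀ h2 (Real.exp_pos _).le h3
  rw [integral_gaussianReal_eq_integral_smul one_ne_zero]
  calc ∫ z, gaussianPDFReal 0 1 z • f (T * (z - θ)) ≤ ∫ z, f (T * (z - θ)) := by
        refine integral_mono_of_nonneg (Filter.Eventually.of_forall fun z =>
          mul_nonneg (gaussianPDFReal_nonneg _ _ _) (hf _)) h1
          (Filter.Eventually.of_forall fun z => ?_)
        exact mul_le_of_le_one_left (hf _) (hpdf z)
    _ = (∫ t, f t) / T := by
        rw [integral_sub_right_eq_self (fun z => f (T * z)) θ,
          Measure.integral_comp_mul_left, abs_of_pos (inv_pos.2 hT), smul_eq_mul, div_eq_inv_mul]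

section Halfspaces

variable {n : ℕ}

/-- A smooth approximation of the indicator function of an intersection of halfspaces. -/
noncomputable def smoothIndicator {m : ℕ} (a : Fin m → EuclideanSpace ℝ (Fin n)) (θ : Fin m → ℝ)
    (T : ℝ) (x : EuclideanSpace ℝ (Fin n)) : ℝ :=
  ∏ i, smoothStep (T * (inner ℝ (a i) x - θ i))

/-- An upper bound for the error of `smoothIndicator` near a single hyperplane. -/
noncomputable def hyperplaneEnvelope (a : EuclideanSpace ℝ (Fin n)) (θ T : ℝ)
    (x : EuclideanSpace ℝ (Fin n)) : ℝ :=
  sincEnvelope (T * (inner ℝ a x - θ))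

lemma abs_smoothStep_le_one (t : ℝ) : |smoothStep t| ≤ 1 :=
  hasExpDerivBound_smoothStep.abs_le_one t

variable {m : ℕ} (a : Fin m → EuclideanSpace ℝ (Fin n)) (θ : Fin m → ℝ) {T : ℝ}

lemma contDiff_smoothIndicator : ContDiff ℝ (⊤ : ℕ∞) (smoothIndicator a θ T) :=
  contDiff_prod fun _ _ => hasExpDerivBound_smoothStep.contDiff.comp
    (contDiff_const.mul ((contDiff_const.inner ℝ contDiff_id).sub contDiff_const))

lemma contDiff_hyperplaneEnvelope (b : EuclideanSpace ℝ (Fin n)) (t : ℝ) :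
    ContDiff ℝ (⊤ : ℕ∞) (hyperplaneEnvelope b t T) :=
  hasExpDerivBound_sincEnvelope.contDiff.comp
    (contDiff_const.mul ((contDiff_const.inner ℝ contDiff_id).sub contDiff_const))

lemma abs_smoothIndicator_le_one (x : EuclideanSpace ℝ (Fin n)) :
    |smoothIndicator a θ T x| ≤ 1 := by
  rw [smoothIndicator, Finset.abs_prod]
  exact Finset.prod_le_one (fun _ _ => abs_nonneg _) fun i _ => abs_smoothStep_le_one _

lemma abs_hyperplaneEnvelope_le_one (b : EuclideanSpace ℝ (Fin n)) (t : ℝ)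
    (x : EuclideanSpace ℝ (Fin n)) : |hyperplaneEnvelope b t T x| ≤ 1 :=
  hasExpDerivBound_sincEnvelope.abs_le_one _

lemma HasExpDerivBound.comp_ray {f : ℝ → ℝ} {B : ℝ} (hf : HasExpDerivBound B f) (hT : 0 ≤ T)
    (b : EuclideanSpace ℝ (Fin n)) (t : ℝ) (x : EuclideanSpace ℝ (Fin n)) :
    HasExpDerivBound (T * B * |inner ℝ b x|) (fun s : ℝ => f (T * (inner ℝ b (s • x) - t))) := by
  have h := hf.comp_mul_add (T * inner ℝ b x) (-(T * t))
  rw [abs_mul, abs_of_nonneg hT] at h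
  convert h using 1
  · ring
  · ext s
    rw [real_inner_smul_right]
    ring_nf

lemma abs_iteratedDeriv_smoothIndicator_le (hT : 0 ≤ T) (x : EuclideanSpace ℝ (Fin n)) (j : ℕ)
    (s : ℝ) :
    |iteratedDeriv j (fun s : ℝ => smoothIndicator a θ T (s • x)) s|
      ≤ (T * smoothingType * ∑ i, |inner ℝ (a i) x|) ^ j := by
  rw [Finset.mul_sum]
  exact (HasExpDerivBound.prod Finset.univ fun i _ =>
    hasExpDerivBound_smoothStep.comp_ray hT (a i) (θ i) x).bound j s

lemma abs_iteratedDeriv_hyperplaneEnvelope_le (hT : 0 ≤ T) (b : EuclideanSpace ℝ (Fin n)) (t : ℝ)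
    (x : EuclideanSpace ℝ (Fin n)) (j : ℕ) (s : ℝ) :
    |iteratedDeriv j (fun s : ℝ => hyperplaneEnvelope b t T (s • x)) s|
      ≤ (T * smoothingType * ∑ _i : Fin 1, |inner ℝ b x|) ^ j := by
  have h : (2 : ℝ) ≤ smoothingType := (by norm_num : (2 : ℝ) ≤ 4).trans (le_max_left _ _)
  simp only [Finset.univ_unique, Finset.sum_const, Finset.card_singleton, one_smul]
  exact ((hasExpDerivBound_sincEnvelope.mono h).comp_ray hT b t x).bound j s

lemma measurableSet_halfspace (b : EuclideanSpace ℝ (Fin n)) (t : ℝ) :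
    MeasurableSet (halfspace b t) :=
  measurableSet_lt measurable_const (by fun_prop)

/-- The indicator is a product of sharp steps; replacing one factor at a time costs the sum of the
one-dimensional errors. -/
lemma abs_indicator_sub_smoothIndicator_le (hT : 0 < T) (x : EuclideanSpace ℝ (Fin n)) :
    |(⋂ i, halfspace (a i) (θ i)).indicator 1 x - smoothIndicator a θ T x|
      ≤ ∑ i, smoothStepError * hyperplaneEnvelope (a i) (θ i) T x := by
  classical
  have h : (⋂ i, halfspace (a i) (θ i)).indicator (1 : EuclideanSpace ℝ (Fin n) → ℝ) x
      = ∏ i, if 0 < T * (inner ℝ (a i) x - θ i) then 1 else 0 := by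
    rw [Finset.prod_ite_zero]
    simp [Set.indicator_apply, halfspace, hT]
  rw [h, abs_sub_comm, smoothIndicator]
  refine (abs_prod_sub_prod_le _ (fun i => abs_smoothStep_le_one _) fun i => ?_).trans
    (Finset.sum_le_sum fun i _ => abs_smoothStep_sub_le _)
  split_ifs <;> simp

variable {Ω' : Type*} [MeasurableSpace Ω'] {k : ℕ} {P' : Measure Ω'} [IsProbabilityMeasure P']
  {Y : Ω' → EuclideanSpace ℝ (Fin n)}

lemma IsKWiseIndepStdGaussianVector.abs_measureReal_sub_integral_le
    (hY : IsKWiseIndepStdGaussianVector k Y P') (hT : 0 < T) :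
    |P'.real {ω | Y ω ∈ ⋂ i, halfspace (a i) (θ i)} - ∫ ω, smoothIndicator a θ T (Y ω) ∂P'|
      ≤ ∑ i, smoothStepError * ∫ ω, hyperplaneEnvelope (a i) (θ i) T (Y ω) ∂P' := by
  have hS : MeasurableSet (⋂ i, halfspace (a i) (θ i)) :=
    MeasurableSet.iInter fun i => measurableSet_halfspace _ _
  have hind : Measurable ((⋂ i, halfspace (a i) (θ i)).indicator
      (1 : EuclideanSpace ℝ (Fin n) → ℝ)) := measurable_one.indicator hS
  have h1 : P'.real {ω | Y ω ∈ ⋂ i, halfspace (a i) (θ i)}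
      = ∫ ω, (⋂ i, halfspace (a i) (θ i)).indicator 1 (Y ω) ∂P' := by
    have h := integral_indicator_one (μ := P'.map Y) hS
    rw [integral_map hY.aemeasurable hind.aestronglyMeasurable, measureReal_def,
      Measure.map_apply_of_aemeasurable hY.aemeasurable hS] at h
    exact h.symm
  have hi1 := hY.integrable_of_bounded hind fun x => by
    by_cases hx : x ∈ ⋂ i, halfspace (a i) (θ i) <;> simp [Set.indicator, hx]
  have hi2 := hY.integrable_of_bounded (contDiff_smoothIndicator a θ (T := T)).continuous.measurable
    (abs_smoothIndicator_le_one a θ)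
  have hi3 : ∀ i, Integrable (fun ω => smoothStepError *
      hyperplaneEnvelope (a i) (θ i) T (Y ω)) P' := fun i =>
    (hY.integrable_of_bounded (contDiff_hyperplaneEnvelope (a i) (θ i)).continuous.measurable
      (abs_hyperplaneEnvelope_le_one _ _)).const_mul _
  rw [h1, ← integral_sub hi1 hi2]
  simp only [← integral_const_mul]
  rw [← integral_finsetSum _ fun i _ => hi3 i]
  exact abs_integral_le_integral_abs.trans (integral_mono_of_nonneg
    (Filter.Eventually.of_forall fun _ => abs_nonneg _) (integrable_finsetSum _ fun i _ => hi3 i)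
    (Filter.Eventually.of_forall fun ω => abs_indicator_sub_smoothIndicator_le a θ hT (Y ω)))

lemma integral_hyperplaneEnvelope_stdGaussian_le {b : EuclideanSpace ℝ (Fin n)} (hb : ‖b‖ = 1)
    (t : ℝ) (hT : 0 < T) :
    ∫ x, hyperplaneEnvelope b t T x ∂(stdGaussian (EuclideanSpace ℝ (Fin n)))
      ≤ (∫ t, sincEnvelope t) / T := by
  have h := (hasLaw_inner_stdGaussian hb).integral_comp (f := fun z => sincEnvelope (T * (z - t)))
    (continuous_sincEnvelope.comp (by fun_prop)).aestronglyMeasurable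
  simp only [Function.comp_def] at h
  simp only [hyperplaneEnvelope, h]
  exact integral_gaussianReal_comp_affine_le sincEnvelope_nonneg integrable_sincEnvelope hT t

lemma IsKWiseIndepStdGaussianVector.abs_measureReal_halfspaces_sub_le_of_even
    (hY : IsKWiseIndepStdGaussianVector k Y P') (ha : ∀ i, ‖a i‖ = 1) (hm : 0 < m)
    {l : ℕ} (hl : l + 1 ≤ k) (hle : Even (l + 1)) (hT : 0 < T)
    (hTm : T * smoothingType * m ≤ √(l + 1 : ℕ) * Real.exp (-(3 / 2))) :
    |P'.real {ω | Y ω ∈ ⋂ i, halfspace (a i) (θ i)}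
        - (stdGaussian (EuclideanSpace ℝ (Fin n))).real (⋂ i, halfspace (a i) (θ i))|
      ≤ m * (smoothStepError * (2 * ((∫ t, sincEnvelope t) / T) + 4 * Real.exp (-(l + 1 : ℕ))))
        + 4 * Real.exp (-(l + 1 : ℕ)) := by
  have hX := (isIndepStdGaussianVector_id (n := n)).isKWise k
  have hL : 0 ≤ T * smoothingType := by have := smoothingType_pos; positivity
  have hm1 : (1 : ℝ) ≤ m := by exact_mod_cast hm
  have e1 := hY.abs_measureReal_sub_integral_le a θ hT
  have e2 := hX.abs_measureReal_sub_integral_le a θ hT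
  have e3 := hY.abs_integral_sub_le ha (contDiff_smoothIndicator a θ)
    (abs_smoothIndicator_le_one a θ) hL hl hle hTm
    (fun x s => abs_iteratedDeriv_smoothIndicator_le a θ hT.le x _ s)
  have e4 : ∀ i, ∫ x, hyperplaneEnvelope (a i) (θ i) T x
      ∂(stdGaussian (EuclideanSpace ℝ (Fin n))) ≤ (∫ t, sincEnvelope t) / T :=
    fun i => integral_hyperplaneEnvelope_stdGaussian_le (ha i) (θ i) hT
  -- Anticoncentration passes from the Gaussian to `Y` because the envelope, a function of one
  -- direction, is itself fooled.
  have e5 : ∀ i, ∫ ω, hyperplaneEnvelope (a i) (θ i) T (Y ω) ∂P'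
      ≤ (∫ t, sincEnvelope t) / T + 4 * Real.exp (-(l + 1 : ℕ)) := by
    intro i
    have h := hY.abs_integral_sub_le (a := fun _ : Fin 1 => a i) (fun _ => ha i)
      (contDiff_hyperplaneEnvelope (a i) (θ i)) (abs_hyperplaneEnvelope_le_one (a i) (θ i))
      hL hl hle (by
        refine le_trans ?_ hTm
        gcongr
        simpa using hm1)
      (fun x s => abs_iteratedDeriv_hyperplaneEnvelope_le hT.le (a i) (θ i) x _ s)
    linarith [(abs_le.1 h).2, e4 i]
  have hK := smoothStepError_pos
  have e6 : ∑ i, smoothStepError * ∫ ω, hyperplaneEnvelope (a i) (θ i) T (Y ω) ∂P'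
      ≤ m * (smoothStepError * ((∫ t, sincEnvelope t) / T + 4 * Real.exp (-(l + 1 : ℕ)))) := by
    refine (Finset.sum_le_sum fun i _ => mul_le_mul_of_nonneg_left (e5 i) hK.le).trans_eq ?_
    simp
  have e7 : ∑ i, smoothStepError * ∫ x, hyperplaneEnvelope (a i) (θ i) T x
      ∂(stdGaussian (EuclideanSpace ℝ (Fin n)))
      ≤ m * (smoothStepError * ((∫ t, sincEnvelope t) / T)) := by
    refine (Finset.sum_le_sum fun i _ => mul_le_mul_of_nonneg_left (e4 i) hK.le).trans_eq ?_
    simp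
  have f1 := abs_le.1 (e1.trans e6)
  have f2 := abs_le.1 (e2.trans e7)
  have f3 := abs_le.1 e3
  simp only [Set.ofPred_mem_eq] at f2
  rw [abs_le]
  constructor <;> linarith

/-- The constant in the error bound for intersections of halfspaces. -/
noncomputable def foolingConstant : ℝ :=
  2 * (smoothStepError * (2 * ((∫ t, sincEnvelope t) * (smoothingType * Real.exp (3 / 2))) + 4)
    + 4)

lemma integral_sincEnvelope_nonneg : 0 ≤ ∫ t, sincEnvelope t := integral_nonneg sincEnvelope_nonneg

lemma eight_le_foolingConstant : 8 ≤ foolingConstant := by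
  have h1 := smoothStepError_pos
  have h2 := smoothingType_pos
  have h3 := integral_sincEnvelope_nonneg
  have : 0 ≤ smoothStepError * (2 * ((∫ t, sincEnvelope t) * (smoothingType * Real.exp (3 / 2))) + 4)
    := by positivity
  unfold foolingConstant
  linarith

lemma IsKWiseIndepStdGaussianVector.abs_measureReal_halfspaces_sub_le
    (hY : IsKWiseIndepStdGaussianVector k Y P') (ha : ∀ i, ‖a i‖ = 1) (hm : 0 < m) (hk : 0 < k) :
    |P'.real {ω | Y ω ∈ ⋂ i, halfspace (a i) (θ i)}
        - (stdGaussian (EuclideanSpace ℝ (Fin n))).real (⋂ i, halfspace (a i) (θ i))|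
      ≤ foolingConstant * m ^ 2 / √k := by
  have hm1 : (1 : ℝ) ≤ m := by exact_mod_cast hm
  -- For `k = 1` no positive even degree is available, but the claimed bound is at least 8 and hence
  -- trivial.
  obtain rfl | hk2 : k = 1 ∨ 2 ≤ k := by lia
  · have h1 : foolingConstant ≤ foolingConstant * m ^ 2 / √(1 : ℕ) := by
      simp only [Nat.cast_one, Real.sqrt_one, div_one]
      exact le_mul_of_one_le_right (by linarith [eight_le_foolingConstant]) (one_le_pow₀ hm1)
    refine le_trans ?_ ((eight_le_foolingConstant).trans h1)
    have h2 : P'.real {ω | Y ω ∈ ⋂ i, halfspace (a i) (θ i)} ≤ 1 := measureReal_le_one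
    have h3 : (stdGaussian (EuclideanSpace ℝ (Fin n))).real (⋂ i, halfspace (a i) (θ i)) ≤ 1 :=
      measureReal_le_one
    have h4 : 0 ≤ P'.real {ω | Y ω ∈ ⋂ i, halfspace (a i) (θ i)} := measureReal_nonneg
    have h5 : 0 ≤ (stdGaussian (EuclideanSpace ℝ (Fin n))).real (⋂ i, halfspace (a i) (θ i)) :=
      measureReal_nonneg
    rw [abs_le]
    constructor <;> linarith
  -- The largest even degree not exceeding `k`.
  · obtain ⟨l, hl⟩ : ∃ l, l + 1 = 2 * (k / 2) := ⟨2 * (k / 2) - 1, by lia⟩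
    have hle : Even (l + 1) := hl ▸ even_two_mul _
    have hB := smoothingType_pos
    have hK := smoothStepError_pos
    have hM := integral_sincEnvelope_nonneg
    set r := √(l + 1 : ℕ) with hr
    have hr0 : 0 < r := Real.sqrt_pos.2 (by positivity)
    have hr1 : Real.exp (-(l + 1 : ℕ)) ≤ 1 / r := by
      rw [Real.exp_neg, ← one_div]
      refine one_div_le_one_div_of_le hr0 ?_
      have h1 : r ≤ (l + 1 : ℕ) := by
        rw [hr, Real.sqrt_le_left (by positivity)]
        have : (1 : ℝ) ≤ (l + 1 : ℕ) := by push_cast; linarith [(Nat.cast_nonneg l : (0 : ℝ) ≤ l)]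
        nlinarith
      linarith [Real.add_one_le_exp ((l + 1 : ℕ) : ℝ)]
    -- Rounding `k` down to an even number loses at most this factor 2, the leading factor of
    -- `foolingConstant`.
    have hrk : √k ≤ 2 * r := by
      rw [hr, Real.sqrt_le_left (by positivity), mul_pow, Real.sq_sqrt (by positivity)]
      have : k ≤ 2 ^ 2 * (l + 1) := by lia
      exact_mod_cast this
    -- This `T` gives equality in the condition on the type, so `1 / T` is a constant times `m / r`.
    have hT : 0 < r * Real.exp (-(3 / 2)) / (smoothingType * m) := by positivity
    have h := hY.abs_measureReal_halfspaces_sub_le_of_even a θ ha hm (by lia : l + 1 ≤ k) hle hT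
      (by
        refine le_of_eq ?_
        rw [← hr]
        field_simp)
    refine h.trans ?_
    have hD : (∫ t, sincEnvelope t) / (r * Real.exp (-(3 / 2)) / (smoothingType * m))
        = (∫ t, sincEnvelope t) * (smoothingType * Real.exp (3 / 2)) * m / r := by
      rw [Real.exp_neg]
      field_simp
    rw [hD]
    set M := (∫ t, sincEnvelope t) * (smoothingType * Real.exp (3 / 2)) with hMdef
    have hM0 : 0 ≤ M := by positivity
    calc m * (smoothStepError * (2 * (M * m / r) + 4 * Real.exp (-(l + 1 : ℕ))))
          + 4 * Real.exp (-(l + 1 : ℕ))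
        ≤ m * (smoothStepError * (2 * (M * m / r) + 4 * (m * (1 / r)))) + 4 * (m ^ 2 * (1 / r)) := by
          have h6 : 1 / r ≤ m * (1 / r) := le_mul_of_one_le_left (by positivity) hm1
          have h7 : 1 / r ≤ m ^ 2 * (1 / r) :=
            le_mul_of_one_le_left (by positivity) (one_le_pow₀ hm1)
          gcongr
          · exact hr1.trans h6
          · exact hr1.trans h7
      _ = (smoothStepError * (2 * M + 4) + 4) * m ^ 2 / r := by
          field_simp
      _ = foolingConstant * m ^ 2 / (2 * r) := by
          rw [foolingConstant, ← hMdef]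
          field_simp
      _ ≤ foolingConstant * m ^ 2 / √k := by
          have := eight_le_foolingConstant
          gcongr

end Halfspaces

/-! ### Gaussian measure of a planar wedge -/

section Wedge

lemma measurableSet_pos_and_neg {α : Type*} [MeasurableSpace α] {f g : α → ℝ} (hf : Measurable f)
    (hg : Measurable g) : MeasurableSet {x | 0 < f x ∧ g x < 0} :=
  (measurableSet_lt measurable_const hf).inter (measurableSet_lt hg measurable_const)

lemma lintegral_mul_exp_neg_sq_div_two :
    ∫⁻ r in Set.Ioi (0 : ℝ), ENNReal.ofReal (r * Real.exp (-r ^ 2 / 2)) = 1 := by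
  have hd : ∀ r ∈ Set.Ici (0 : ℝ), HasDerivAt (fun r : ℝ => -Real.exp (-r ^ 2 / 2))
      (r * Real.exp (-r ^ 2 / 2)) r := by
    intro r _
    have h1 : HasDerivAt (fun r : ℝ => -r ^ 2 / 2) (-r) r := by
      refine (((hasDerivAt_id r).pow 2).neg.div_const 2).congr_deriv ?_
      simp
      ring
    refine h1.exp.neg.congr_deriv ?_
    ring
  have hlim : Filter.Tendsto (fun r : ℝ => -Real.exp (-r ^ 2 / 2)) Filter.atTop (nhds (-0)) := by
    refine (Real.tendsto_exp_atBot.comp ?_).neg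
    have : Filter.Tendsto (fun r : ℝ => -(r ^ 2 / 2)) Filter.atTop Filter.atBot :=
      Filter.tendsto_neg_atTop_atBot.comp
        ((Filter.tendsto_pow_atTop two_ne_zero).atTop_div_const two_pos)
    refine this.congr fun r => by ring
  have hpos : ∀ r ∈ Set.Ioi (0 : ℝ), 0 ≤ r * Real.exp (-r ^ 2 / 2) := fun r hr =>
    mul_nonneg (le_of_lt hr) (Real.exp_pos _).le
  have h1 := integral_Ioi_of_hasDerivAt_of_nonneg' hd hpos hlim
  have h2 := integrableOn_Ioi_deriv_of_nonneg' hd hpos hlim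
  rw [← ofReal_integral_eq_lintegral_ofReal h2
    ((ae_restrict_iff' measurableSet_Ioi).2 (Filter.Eventually.of_forall hpos)), h1]
  simp

lemma gaussianPDF_mul_gaussianPDF (u v : ℝ) :
    gaussianPDF 0 1 u * gaussianPDF 0 1 v
      = ENNReal.ofReal ((2 * Real.pi)⁻¹ * Real.exp (-(u ^ 2 + v ^ 2) / 2)) := by
  simp only [gaussianPDF]
  rw [← ENNReal.ofReal_mul (gaussianPDFReal_nonneg _ _ _)]
  congr 1
  simp only [gaussianPDFReal, NNReal.coe_one, mul_one, sub_zero]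
  have h : (√(2 * Real.pi))⁻¹ * (√(2 * Real.pi))⁻¹ = (2 * Real.pi)⁻¹ := by
    rw [← mul_inv, Real.mul_self_sqrt (by positivity)]
  rw [mul_mul_mul_comm, h, ← Real.exp_add]
  congr 2
  ring

/-- In polar coordinates the conditions read `cos t > 0` and `cos (φ - t) < 0`. They hold on the
sector `-π/2 < t < φ - π/2` of opening `φ`, and the radial integral is 1. Only the lower bound is
needed, so the inclusion of the sector suffices. -/
lemma gaussianReal_prod_wedge_ge {φ : ℝ} (h0 : 0 ≤ φ) (hπ : φ ≤ Real.pi) :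
    ENNReal.ofReal (φ / (2 * Real.pi)) ≤ ((gaussianReal 0 1).prod (gaussianReal 0 1))
      {p : ℝ × ℝ | 0 < p.1 ∧ Real.cos φ * p.1 + Real.sin φ * p.2 < 0} := by
  set W := {p : ℝ × ℝ | 0 < p.1 ∧ Real.cos φ * p.1 + Real.sin φ * p.2 < 0} with hW
  have hWm : MeasurableSet W :=
    measurableSet_pos_and_neg (by fun_prop) (by fun_prop)
  have h1 : ((gaussianReal 0 1).prod (gaussianReal 0 1)) W
      = ∫⁻ p : ℝ × ℝ, W.indicator (fun p => ENNReal.ofReal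
          ((2 * Real.pi)⁻¹ * Real.exp (-(p.1 ^ 2 + p.2 ^ 2) / 2))) p := by
    rw [gaussianReal_of_var_ne_zero 0 one_ne_zero,
      prod_withDensity (measurable_gaussianPDF _ _) (measurable_gaussianPDF _ _),
      withDensity_apply _ hWm, lintegral_indicator hWm]
    simp only [gaussianPDF_mul_gaussianPDF]
    rfl
  rw [h1, ← lintegral_comp_polarCoord_symm]
  have hsub : Set.Ioi (0 : ℝ) ×ˢ Set.Ioo (-(Real.pi / 2)) (φ - Real.pi / 2) ⊆ polarCoord.target := by
    rw [polarCoord_target]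
    refine Set.prod_mono le_rfl (Set.Ioo_subset_Ioo ?_ ?_) <;> linarith [Real.pi_pos]
  refine le_trans ?_ (lintegral_mono_set hsub)
  have h2 : ∀ p ∈ Set.Ioi (0 : ℝ) ×ˢ Set.Ioo (-(Real.pi / 2)) (φ - Real.pi / 2),
      ENNReal.ofReal p.1 • W.indicator (fun p => ENNReal.ofReal
          ((2 * Real.pi)⁻¹ * Real.exp (-(p.1 ^ 2 + p.2 ^ 2) / 2))) (polarCoord.symm p)
        = ENNReal.ofReal (p.1 * Real.exp (-p.1 ^ 2 / 2)) * ENNReal.ofReal (2 * Real.pi)⁻¹ := by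
    rintro ⟨r, t⟩ ⟨hr, ht1, ht2⟩
    have hr : 0 < r := hr
    have hmem : polarCoord.symm (r, t) ∈ W := by
      rw [polarCoord_symm_apply]
      refine ⟨mul_pos hr (Real.cos_pos_of_mem_Ioo ⟨ht1, by simp only at ht2; linarith⟩), ?_⟩
      have h3 : Real.cos φ * (r * Real.cos t) + Real.sin φ * (r * Real.sin t)
          = r * Real.cos (φ - t) := by rw [Real.cos_sub]; ring
      simp only at ht1 ht2 ⊢
      rw [h3]
      exact mul_neg_of_pos_of_neg hr
        (Real.cos_neg_of_pi_div_two_lt_of_lt (by linarith) (by linarith))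
    rw [Set.indicator_of_mem hmem, polarCoord_symm_apply, smul_eq_mul,
      ← ENNReal.ofReal_mul hr.le, ← ENNReal.ofReal_mul (by positivity)]
    congr 1
    have h4 : (r * Real.cos t) ^ 2 + (r * Real.sin t) ^ 2 = r ^ 2 := by
      linear_combination r ^ 2 * Real.sin_sq_add_cos_sq t
    simp only [h4]
    ring
  rw [setLIntegral_congr_fun (measurableSet_Ioi.prod measurableSet_Ioo) h2,
    Measure.volume_eq_prod, ← Measure.prod_restrict,
    lintegral_prod_mul (f := fun r => ENNReal.ofReal (r * Real.exp (-r ^ 2 / 2)))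
      (g := fun _ => ENNReal.ofReal (2 * Real.pi)⁻¹) (by fun_prop) (by fun_prop),
    lintegral_mul_exp_neg_sq_div_two, one_mul, lintegral_const, Measure.restrict_apply_univ,
    Real.volume_Ioo, ← ENNReal.ofReal_mul (by positivity)]
  refine ENNReal.ofReal_le_ofReal (le_of_eq ?_)
  field_simp
  ring

end Wedge

/-! ### Hyperplane rounding with a true Gaussian -/

section Rounding

variable {n : ℕ}

lemma hasLaw_inner_pair_stdGaussian {a c : EuclideanSpace ℝ (Fin n)} (ha : ‖a‖ = 1)
    (hc : ‖c‖ = 1) (hac : inner ℝ a c = 0) :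
    HasLaw (fun x => ((inner ℝ a x : ℝ), (inner ℝ c x : ℝ)))
      ((gaussianReal 0 1).prod (gaussianReal 0 1)) (stdGaussian (EuclideanSpace ℝ (Fin n))) := by
  refine ⟨by fun_prop, ?_⟩
  have hg : HasGaussianLaw (fun x => ((inner ℝ a x : ℝ), (inner ℝ c x : ℝ)))
      (stdGaussian (EuclideanSpace ℝ (Fin n))) :=
    (IsGaussian.hasGaussianLaw_id (μ := stdGaussian (EuclideanSpace ℝ (Fin n)))).map
      ((innerSL ℝ a).prod (innerSL ℝ c))
  have hcov : cov[fun x => inner ℝ a x, fun x => inner ℝ c x;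
      stdGaussian (EuclideanSpace ℝ (Fin n))] = 0 := by
    rw [← covarianceBilin_apply_eq_cov IsGaussian.memLp_two_id, covarianceBilin_stdGaussian]
    exact hac
  have hind := hg.indepFun_of_covariance_eq_zero hcov
  rw [(indepFun_iff_map_prod_eq_prod_map_map (by fun_prop) (by fun_prop)).1 hind,
    (hasLaw_inner_stdGaussian ha).map_eq, (hasLaw_inner_stdGaussian hc).map_eq]

/-- Gram-Schmidt: `b = cos φ • a + sin φ • c` with `c` a unit vector orthogonal to `a`, which
reduces to the planar wedge. Strict bounds on the inner product make `sin φ` nonzero. -/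
lemma stdGaussian_wedge_ge {a b : EuclideanSpace ℝ (Fin n)} (ha : ‖a‖ = 1) (hb : ‖b‖ = 1)
    (h1 : -1 < (inner ℝ a b : ℝ)) (h2 : (inner ℝ a b : ℝ) < 1) :
    ENNReal.ofReal (Real.arccos (inner ℝ a b) / (2 * Real.pi))
      ≤ stdGaussian (EuclideanSpace ℝ (Fin n)) {x | 0 < inner ℝ a x ∧ inner ℝ b x < 0} := by
  set φ := Real.arccos (inner ℝ a b) with hφ
  have hcos : Real.cos φ = inner ℝ a b := Real.cos_arccos h1.le h2.le
  have hsin : 0 < Real.sin φ := by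
    rw [hφ, Real.sin_arccos, Real.sqrt_pos]
    nlinarith
  have hsc := Real.sin_sq_add_cos_sq φ
  set c : EuclideanSpace ℝ (Fin n) := (Real.sin φ)⁻¹ • (b - Real.cos φ • a) with hc
  have haa : (inner ℝ a a : ℝ) = 1 := by rw [real_inner_self_eq_norm_sq, ha, one_pow]
  have hbb : (inner ℝ b b : ℝ) = 1 := by rw [real_inner_self_eq_norm_sq, hb, one_pow]
  have hac : (inner ℝ a c : ℝ) = 0 := by
    rw [hc, real_inner_smul_right, inner_sub_right, real_inner_smul_right, haa, hcos]
    ring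
  have hcn : ‖c‖ = 1 := by
    have h3 : ‖c‖ ^ 2 = 1 := by
      rw [← real_inner_self_eq_norm_sq, hc, real_inner_smul_left, real_inner_smul_right,
        inner_sub_left, inner_sub_right, inner_sub_right, real_inner_smul_left,
        real_inner_smul_right, real_inner_smul_left, real_inner_smul_right, haa, hbb,
        real_inner_comm a b, ← hcos]
      field_simp
      linarith
    have := norm_nonneg c
    nlinarith
  have hbx : ∀ x, (inner ℝ b x : ℝ) = Real.cos φ * inner ℝ a x + Real.sin φ * inner ℝ c x := by
    intro x
    rw [hc, real_inner_smul_left, inner_sub_left, real_inner_smul_left]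
    field_simp
    ring
  have hlaw := hasLaw_inner_pair_stdGaussian ha hcn hac
  refine (gaussianReal_prod_wedge_ge (Real.arccos_nonneg _) (Real.arccos_le_pi _)).trans ?_
  rw [← hlaw.map_eq, Measure.map_apply_of_aemeasurable hlaw.aemeasurable]
  · refine measure_mono fun x hx => ?_
    have hx : 0 < inner ℝ a x ∧ Real.cos φ * inner ℝ a x + Real.sin φ * inner ℝ c x < 0 := hx
    rw [← hbx] at hx
    exact hx
  · exact measurableSet_pos_and_neg (by fun_prop) (by fun_prop)

lemma sgn_of_neg {t : ℝ} (h : t < 0) : sgn t = -1 := if_pos h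

lemma sgn_of_nonneg {t : ℝ} (h : 0 ≤ t) : sgn t = 1 := if_neg h.not_gt

/-- The signs differ on two disjoint antipodal wedges, of equal measure by the symmetry `x ↦ -x`.
Parallel vectors are treated separately. -/
lemma stdGaussian_real_sgn_ne_ge {a b : EuclideanSpace ℝ (Fin n)} (ha : ‖a‖ = 1) (hb : ‖b‖ = 1) :
    Real.arccos (inner ℝ a b) / Real.pi ≤ (stdGaussian (EuclideanSpace ℝ (Fin n))).real
      {x | sgn (inner ℝ a x) ≠ sgn (inner ℝ b x)} := by
  have hle := abs_le.1 ((abs_real_inner_le_norm a b).trans_eq (by rw [ha, hb, one_mul]))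
  have hpi := Real.pi_pos
  rcases hle.1.eq_or_lt with h1 | h1
  · have hba : b = -a := by
      have h2 : ‖a + b‖ ^ 2 = 0 := by
        rw [norm_add_sq_real, ha, hb, ← h1]
        norm_num
      exact (neg_eq_of_add_eq_zero_right (norm_eq_zero.1 (pow_eq_zero_iff two_ne_zero |>.1 h2))).symm
    -- Since `sgn 0 = 1`, opposite vectors get the same sign on the hyperplane orthogonal to `a`;
    -- that hyperplane is null.
    have h3 : (stdGaussian (EuclideanSpace ℝ (Fin n))) {x | inner ℝ a x = 0} = 0 := by
      have hl := hasLaw_inner_stdGaussian ha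
      have : (stdGaussian (EuclideanSpace ℝ (Fin n))).map (fun x => inner ℝ a x) {(0 : ℝ)} = 0 := by
        rw [hl.map_eq]
        have := nullSingletonClass_gaussianReal (μ := 0) (v := 1) one_ne_zero
        simp
      rwa [Measure.map_apply_of_aemeasurable hl.aemeasurable (measurableSet_singleton 0)] at this
    have hm : MeasurableSet {x : EuclideanSpace ℝ (Fin n) | inner ℝ a x = (0 : ℝ)} :=
      measurableSet_eq_fun (by fun_prop) measurable_const
    have h4 : (stdGaussian (EuclideanSpace ℝ (Fin n))).real {x | inner ℝ a x = (0 : ℝ)}ᶜ = 1 := by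
      rw [measureReal_def, (prob_compl_eq_one_iff hm).2 h3, ENNReal.toReal_one]
    rw [← h1, Real.arccos_neg_one, div_self hpi.ne', ← h4]
    refine measureReal_mono fun x hx => ?_
    have hx : (inner ℝ a x : ℝ) ≠ 0 := hx
    simp only [Set.mem_ofPred_eq, hba, inner_neg_left]
    rcases hx.lt_or_gt with hx | hx
    · rw [sgn_of_neg hx, sgn_of_nonneg (by linarith)]
      norm_num
    · rw [sgn_of_nonneg hx.le, sgn_of_neg (by linarith)]
      norm_num
  rcases hle.2.eq_or_lt with h2 | h2
  · rw [h2, Real.arccos_one, zero_div]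
    exact measureReal_nonneg
  have hw := stdGaussian_wedge_ge ha hb h1 h2
  set γ := stdGaussian (EuclideanSpace ℝ (Fin n)) with hγ
  set S := {x : EuclideanSpace ℝ (Fin n) | 0 < inner ℝ a x ∧ inner ℝ b x < 0} with hS
  set S' := {x : EuclideanSpace ℝ (Fin n) | 0 < inner ℝ b x ∧ inner ℝ a x < 0} with hS'
  have hSm : MeasurableSet S :=
    measurableSet_pos_and_neg (by fun_prop) (by fun_prop)
  have hSm' : MeasurableSet S' :=
    measurableSet_pos_and_neg (by fun_prop) (by fun_prop)
  have hneg : γ S' = γ S := by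
    have h := stdGaussian_map (LinearIsometryEquiv.neg ℝ (E := EuclideanSpace ℝ (Fin n)))
    conv_rhs => rw [hγ, ← h, Measure.map_apply (LinearIsometryEquiv.continuous _).measurable hSm]
    congr 1
    ext x
    simp [hS, hS', and_comm]
  have hdisj : Disjoint S S' := by
    rw [Set.disjoint_left]
    rintro x ⟨hx, -⟩ ⟨-, hx'⟩
    exact lt_asymm hx hx'
  have hsub : S ∪ S' ⊆ {x | sgn (inner ℝ a x) ≠ sgn (inner ℝ b x)} := by
    rintro x (⟨hx, hx'⟩ | ⟨hx', hx⟩)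
    · simp only [Set.mem_ofPred_eq, sgn_of_nonneg hx.le, sgn_of_neg hx']
      norm_num
    · simp only [Set.mem_ofPred_eq, sgn_of_nonneg hx'.le, sgn_of_neg hx]
      norm_num
  have h5 : γ.real (S ∪ S') = γ.real S + γ.real S := by
    rw [measureReal_union hdisj hSm', measureReal_def γ S', hneg, ← measureReal_def]
  have h6 : Real.arccos (inner ℝ a b) / (2 * Real.pi) ≤ γ.real S :=
    (ENNReal.ofReal_le_iff_le_toReal (measure_ne_top _ _)).1 hw
  refine le_trans ?_ (measureReal_mono hsub)
  rw [h5]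
  have h7 : Real.arccos (inner ℝ a b) / Real.pi = 2 * (Real.arccos (inner ℝ a b) / (2 * Real.pi)) := by
    field_simp
  linarith

end Rounding

/-! ### Hyperplane rounding under `k`-wise independence -/

section Rounding

variable {n : ℕ}

/-- With `-a` and `-b` the halfspaces are exactly the sets where `sgn` is `-1`, so ties at 0 need no
separate treatment. -/
lemma setOf_sgn_ne (a b : EuclideanSpace ℝ (Fin n)) :
    {x | sgn (inner ℝ a x) ≠ sgn (inner ℝ b x)}
      = (halfspace (-a) 0 \ halfspace (-b) 0) ∪ (halfspace (-b) 0 \ halfspace (-a) 0) := by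
  ext x
  simp only [halfspace, Set.mem_ofPred_eq, Set.mem_union, Set.mem_sdiff, inner_neg_left,
    Left.neg_pos_iff, sgn]
  by_cases h1 : inner ℝ a x < 0 <;> by_cases h2 : inner ℝ b x < 0 <;> simp [h1, h2] <;> norm_num

lemma measurableSet_sgn_ne (a b : EuclideanSpace ℝ (Fin n)) :
    MeasurableSet {x : EuclideanSpace ℝ (Fin n) | sgn (inner ℝ a x) ≠ sgn (inner ℝ b x)} := by
  rw [setOf_sgn_ne]
  have h := measurableSet_halfspace (-a) 0
  have h' := measurableSet_halfspace (-b) 0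
  exact (h.diff h').union (h'.diff h)

lemma measureReal_sgn_ne (ν : Measure (EuclideanSpace ℝ (Fin n))) [IsFiniteMeasure ν]
    (a b : EuclideanSpace ℝ (Fin n)) :
    ν.real {x | sgn (inner ℝ a x) ≠ sgn (inner ℝ b x)}
      = ν.real (halfspace (-a) 0) + ν.real (halfspace (-b) 0)
        - 2 * ν.real (halfspace (-a) 0 ∩ halfspace (-b) 0) := by
  have h := measurableSet_halfspace (-a) 0
  have h' := measurableSet_halfspace (-b) 0
  rw [setOf_sgn_ne, measureReal_union disjoint_sdiff_sdiff (h'.diff h)]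
  have h1 := measureReal_sdiff_add_inter (μ := ν) (s := halfspace (-a) 0) h'
  have h2 := measureReal_sdiff_add_inter (μ := ν) (s := halfspace (-b) 0) h
  rw [Set.inter_comm] at h2
  linarith

variable {Ω' : Type*} [MeasurableSpace Ω'] {k : ℕ} {P' : Measure Ω'}
  {Y : Ω' → EuclideanSpace ℝ (Fin n)}

lemma IsKWiseIndepStdGaussianVector.map_real_apply (hY : IsKWiseIndepStdGaussianVector k Y P')
    {S : Set (EuclideanSpace ℝ (Fin n))} (hS : MeasurableSet S) :
    (P'.map Y).real S = P'.real {ω | Y ω ∈ S} := by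
  rw [measureReal_def, Measure.map_apply_of_aemeasurable hY.aemeasurable hS]
  rfl

variable [IsProbabilityMeasure P']

lemma IsKWiseIndepStdGaussianVector.abs_map_real_halfspace_sub_le
    (hY : IsKWiseIndepStdGaussianVector k Y P') (hk : 0 < k) {a : EuclideanSpace ℝ (Fin n)}
    (ha : ‖a‖ = 1) (θ : ℝ) :
    |(P'.map Y).real (halfspace a θ) - (stdGaussian (EuclideanSpace ℝ (Fin n))).real (halfspace a θ)|
      ≤ foolingConstant / √k := by
  have h := hY.abs_measureReal_halfspaces_sub_le (fun _ : Fin 1 => a) (fun _ => θ) (fun _ => ha)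
    one_pos hk
  simp only [Set.iInter_const, Nat.cast_one, one_pow, mul_one] at h
  rwa [hY.map_real_apply (measurableSet_halfspace a θ)]

lemma iInter_fin_two_halfspace (a b : EuclideanSpace ℝ (Fin n)) (θ₁ θ₂ : ℝ) :
    ⋂ i, halfspace (![a, b] i) (![θ₁, θ₂] i) = halfspace a θ₁ ∩ halfspace b θ₂ := by
  ext x
  simp [Fin.forall_fin_two]

lemma IsKWiseIndepStdGaussianVector.abs_map_real_inter_halfspace_sub_le
    (hY : IsKWiseIndepStdGaussianVector k Y P') (hk : 0 < k) {a b : EuclideanSpace ℝ (Fin n)}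
    (ha : ‖a‖ = 1) (hb : ‖b‖ = 1) (θ₁ θ₂ : ℝ) :
    |(P'.map Y).real (halfspace a θ₁ ∩ halfspace b θ₂)
        - (stdGaussian (EuclideanSpace ℝ (Fin n))).real (halfspace a θ₁ ∩ halfspace b θ₂)|
      ≤ 4 * foolingConstant / √k := by
  have h := hY.abs_measureReal_halfspaces_sub_le ![a, b] ![θ₁, θ₂]
    (Fin.forall_fin_two.2 ⟨ha, hb⟩) two_pos hk
  rw [iInter_fin_two_halfspace] at h
  rw [hY.map_real_apply ((measurableSet_halfspace a θ₁).inter (measurableSet_halfspace b θ₂))]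
  refine h.trans_eq ?_
  push_cast
  ring

lemma IsKWiseIndepStdGaussianVector.abs_measureReal_sgn_ne_sub_le
    (hY : IsKWiseIndepStdGaussianVector k Y P') (hk : 0 < k) {a b : EuclideanSpace ℝ (Fin n)}
    (ha : ‖a‖ = 1) (hb : ‖b‖ = 1) :
    |P'.real {ω | sgn (inner ℝ a (Y ω)) ≠ sgn (inner ℝ b (Y ω))}
        - (stdGaussian (EuclideanSpace ℝ (Fin n))).real
          {x | sgn (inner ℝ a x) ≠ sgn (inner ℝ b x)}|
      ≤ 10 * foolingConstant / √k := by
  have hν : IsProbabilityMeasure (P'.map Y) := Measure.isProbabilityMeasure_map hY.aemeasurable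
  have h1 := abs_le.1 (hY.abs_map_real_halfspace_sub_le hk (a := -a) (by simpa using ha) 0)
  have h2 := abs_le.1 (hY.abs_map_real_halfspace_sub_le hk (a := -b) (by simpa using hb) 0)
  have h3 := abs_le.1 (hY.abs_map_real_inter_halfspace_sub_le hk (a := -a) (b := -b)
    (by simpa using ha) (by simpa using hb) 0 0)
  have h4 := hY.map_real_apply (measurableSet_sgn_ne a b)
  simp only [Set.mem_ofPred_eq] at h4
  rw [← h4, measureReal_sgn_ne, measureReal_sgn_ne]
  -- Inclusion-exclusion uses each halfspace once and the intersection twice; the latter costs `m ^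
  -- 2 = 4` each time.
  have h5 : 10 * foolingConstant / √k
      = foolingConstant / √k + foolingConstant / √k + 2 * (4 * foolingConstant / √k) := by ring
  rw [h5, abs_le]
  constructor <;> linarith

lemma goemansWilliamsonConstant_nonneg : 0 ≤ goemansWilliamsonConstant := by
  refine Real.sInf_nonneg ?_
  rintro _ ⟨φ, hφ, rfl⟩
  have h1 := hφ.1
  have h2 := sub_nonneg.2 (Real.cos_le_one φ)
  have := Real.pi_pos
  positivity

/-- The infimum defining the constant is tested at `φ = arccos c`; at `c = 1` both sides vanish. -/
lemma goemansWilliamsonConstant_mul_le {c : ℝ} (h1 : -1 ≤ c) (h2 : c ≤ 1) :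
    goemansWilliamsonConstant * ((1 - c) / 2) ≤ Real.arccos c / Real.pi := by
  rcases h2.eq_or_lt with rfl | h2
  · simp
  have hφ : Real.arccos c ∈ Set.Ioc 0 Real.pi := ⟨Real.arccos_pos.2 h2, Real.arccos_le_pi c⟩
  have hle : goemansWilliamsonConstant ≤ 2 / Real.pi * (Real.arccos c / (1 - c)) := by
    refine csInf_le ⟨0, ?_⟩ ⟨Real.arccos c, hφ, ?_⟩
    · rintro _ ⟨φ, hφ, rfl⟩
      have h1 := hφ.1
      have h2 := sub_nonneg.2 (Real.cos_le_one φ)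
      have := Real.pi_pos
      positivity
    · simp only [Real.cos_arccos h1 h2.le]
  have hc : 0 < 1 - c := by linarith
  refine (mul_le_mul_of_nonneg_right hle (by positivity)).trans_eq ?_
  field_simp

end Rounding

/-! ### Goemans-Williamson rounding for MaxCut -/

section MaxCut

open Classical in
/-- The indicator of the edge `e` being cut by `σ`. -/
noncomputable def cutIndicator {V : Type*} (σ : V → ℝ) (e : Sym2 V) : ℝ :=
  if ∃ u v, e = s(u, v) ∧ σ u ≠ σ v then 1 else 0

lemma cutIndicator_mk {V : Type*} (σ : V → ℝ) (u v : V) :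
    cutIndicator σ s(u, v) = if σ u = σ v then 0 else 1 := by
  classical
  have h : (∃ u' v', s(u, v) = s(u', v') ∧ σ u' ≠ σ v') ↔ σ u ≠ σ v := by
    constructor
    · rintro ⟨u', v', h, h'⟩
      rcases Sym2.eq_iff.1 h with ⟨rfl, rfl⟩ | ⟨rfl, rfl⟩
      · exact h'
      · exact h'.symm
    · exact fun h => ⟨u, v, rfl, h⟩
  rw [cutIndicator]
  simp only [h, ne_eq, ite_not]

variable {V : Type*} [Fintype V] (G : SimpleGraph V) (w : Sym2 V → ℝ)

open Classical in
lemma cutWeight_eq (σ : V → ℝ) :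
    cutWeight G w σ = ∑ e ∈ G.edgeFinset, w e * cutIndicator σ e := by
  rw [cutWeight, Finset.sum_filter]
  refine Finset.sum_congr rfl fun e _ => ?_
  rw [cutIndicator, mul_ite, mul_one, mul_zero]
  congr

lemma cutWeight_le_maxCut (S : Set V) : cutWeight G w (S.indicator 1) ≤ maxCut G w :=
  le_ciSup (f := fun S : Set V => cutWeight G w (S.indicator 1)) (Set.finite_range _).bddAbove S

open Classical in
lemma cutIndicator_indicator {V : Type*} (S : Set V) (u v : V) :
    cutIndicator (S.indicator 1) s(u, v) = if (u ∈ S ↔ v ∈ S) then 0 else 1 := by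
  rw [cutIndicator_mk]
  by_cases hu : u ∈ S <;> by_cases hv : v ∈ S <;> simp [hu, hv]

/-- Moving one endpoint to the other side is an involution on cuts that exchanges those separating
the edge with those that do not. -/
lemma sum_cutIndicator {e : Sym2 V} (he : ¬ e.IsDiag) :
    2 * ∑ S : Set V, cutIndicator (S.indicator 1) e = Fintype.card (Set V) := by
  classical
  induction e using Sym2.ind with
  | _ u v =>
  have huv : v ≠ u := fun h => he (by simp [h])
  have hinv : Function.Involutive fun S : Set V => symmDiff S {u} := fun S =>
    symmDiff_symmDiff_cancel_right _ _
  have h1 : ∑ S : Set V, cutIndicator (S.indicator 1) s(u, v)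
      = ∑ S : Set V, (1 - cutIndicator (S.indicator 1) s(u, v)) := by
    rw [← Equiv.sum_comp hinv.toPerm]
    refine Finset.sum_congr rfl fun S _ => ?_
    rw [cutIndicator_indicator, cutIndicator_indicator]
    by_cases hu : u ∈ S <;> by_cases hv : v ∈ S <;>
      simp [Set.mem_symmDiff, hu, hv, huv]
  rw [Finset.sum_sub_distrib] at h1
  simp only [Finset.sum_const, Finset.card_univ, nsmul_eq_mul, mul_one] at h1
  linarith

open Classical in
-- The average over all cuts is half the total weight, and the maximum is at least the average.
lemma sum_weight_le_two_mul_maxCut : ∑ e ∈ G.edgeFinset, w e ≤ 2 * maxCut G w := by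
  have hc : (0 : ℝ) < Fintype.card (Set V) := by exact_mod_cast Fintype.card_pos
  have h1 : ∑ S : Set V, cutWeight G w (S.indicator 1) ≤ Fintype.card (Set V) * maxCut G w := by
    refine (Finset.sum_le_sum fun S _ => cutWeight_le_maxCut G w S).trans_eq ?_
    simp
  have h2 : 2 * ∑ S : Set V, cutWeight G w (S.indicator 1)
      = Fintype.card (Set V) * ∑ e ∈ G.edgeFinset, w e := by
    simp only [cutWeight_eq]
    rw [Finset.sum_comm, Finset.mul_sum, Finset.mul_sum]
    refine Finset.sum_congr rfl fun e he => ?_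
    rw [← Finset.mul_sum, ← sum_cutIndicator
      (G.not_isDiag_of_mem_edgeSet (SimpleGraph.mem_edgeFinset.1 he))]
    ring
  nlinarith

variable {n : ℕ}

/-- The contribution `(1 - ⟨x_u, x_v⟩) / 2` of the edge `uv` to the relaxation. -/
noncomputable def edgeValue {V : Type*} (x : V → EuclideanSpace ℝ (Fin n)) : Sym2 V → ℝ :=
  Sym2.lift ⟨fun u v => (1 - inner ℝ (x u) (x v)) / 2, fun u v => by simp only [real_inner_comm]⟩

open Classical in
lemma sdpValue_eq (x : V → EuclideanSpace ℝ (Fin n)) :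
    sdpValue G w x = ∑ e ∈ G.edgeFinset, w e * edgeValue x e := rfl

lemma edgeValue_sign {V : Type*} (e₀ : EuclideanSpace ℝ (Fin n)) (he : ‖e₀‖ = 1) (S : Set V)
    [DecidablePred (· ∈ S)] (e : Sym2 V) :
    edgeValue (fun u => if u ∈ S then e₀ else -e₀) e = cutIndicator (S.indicator 1) e := by
  induction e using Sym2.ind with
  | _ u v =>
  rw [cutIndicator_indicator, edgeValue, Sym2.lift_mk]
  by_cases hu : u ∈ S <;> by_cases hv : v ∈ S <;>
    simp [hu, hv, he]

lemma IsOptimalSdpSolution.maxCut_le {G : SimpleGraph V} {w : Sym2 V → ℝ}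
    {x : V → EuclideanSpace ℝ (Fin n)} (hx : IsOptimalSdpSolution G w x) :
    maxCut G w ≤ sdpValue G w x := by
  classical
  refine ciSup_le fun S => ?_
  -- A cut is encoded by the vectors `±x u₀`. Taking the unit vector from the solution itself
  -- guarantees that one exists in dimension `n`; without vertices there are no edges.
  rcases isEmpty_or_nonempty V with hV | ⟨⟨u₀⟩⟩
  · rw [cutWeight_eq, sdpValue_eq]
    refine (Finset.sum_congr rfl fun e _ => ?_).le
    exact isEmptyElim e
  · have h := hx.2 (fun u => if u ∈ S then x u₀ else -x u₀) fun u => by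
      split_ifs <;> simp [hx.1 u₀]
    rw [sdpValue_eq] at h
    simp only [edgeValue_sign (x u₀) (hx.1 u₀) S] at h
    rwa [← cutWeight_eq] at h

variable {Ω' : Type*} [MeasurableSpace Ω'] {k : ℕ} {P' : Measure Ω'}
  {r : Ω' → EuclideanSpace ℝ (Fin n)}

lemma cutIndicator_sgn {V : Type*} (x : V → EuclideanSpace ℝ (Fin n)) (y : EuclideanSpace ℝ (Fin n)) (u v : V) :
    cutIndicator (fun u => sgn (inner ℝ (x u) y)) s(u, v)
      = {y | sgn (inner ℝ (x u) y) ≠ sgn (inner ℝ (x v) y)}.indicator 1 y := by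
  classical
  rw [cutIndicator_mk, Set.indicator_apply]
  simp only [Set.mem_ofPred_eq, ne_eq, ite_not, Pi.one_apply]

lemma IsKWiseIndepStdGaussianVector.integral_cutIndicator {V : Type*}
    (hr : IsKWiseIndepStdGaussianVector k r P') (x : V → EuclideanSpace ℝ (Fin n)) (u v : V) :
    ∫ ω, cutIndicator (fun u => sgn (inner ℝ (x u) (r ω))) s(u, v) ∂P'
      = P'.real {ω | sgn (inner ℝ (x u) (r ω)) ≠ sgn (inner ℝ (x v) (r ω))} := by
  simp only [cutIndicator_sgn]
  have hS := measurableSet_sgn_ne (x u) (x v)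
  have h := integral_indicator_one (μ := P'.map r) hS
  rw [integral_map hr.aemeasurable (measurable_one.indicator hS).aestronglyMeasurable,
    hr.map_real_apply hS] at h
  exact h

variable [IsProbabilityMeasure P']

lemma IsKWiseIndepStdGaussianVector.integrable_cutIndicator {V : Type*}
    (hr : IsKWiseIndepStdGaussianVector k r P') (x : V → EuclideanSpace ℝ (Fin n)) (e : Sym2 V) :
    Integrable (fun ω => cutIndicator (fun u => sgn (inner ℝ (x u) (r ω))) e) P' := by
  induction e using Sym2.ind with
  | _ u v =>
  simp only [cutIndicator_sgn]
  refine hr.integrable_of_bounded (measurable_one.indicator (measurableSet_sgn_ne (x u) (x v)))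
    fun y => ?_
  classical
  rw [Set.indicator_apply]
  split_ifs <;> simp

lemma IsKWiseIndepStdGaussianVector.edgeValue_le_integral_cutIndicator {V : Type*}
    (hr : IsKWiseIndepStdGaussianVector k r P') (hk : 0 < k) {x : V → EuclideanSpace ℝ (Fin n)}
    (hx : ∀ u, ‖x u‖ = 1) (e : Sym2 V) :
    goemansWilliamsonConstant * edgeValue x e - 10 * foolingConstant / √k
      ≤ ∫ ω, cutIndicator (fun u => sgn (inner ℝ (x u) (r ω))) e ∂P' := by
  induction e using Sym2.ind with
  | _ u v =>
  rw [hr.integral_cutIndicator, edgeValue, Sym2.lift_mk]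
  have h1 := abs_le.1 (hr.abs_measureReal_sgn_ne_sub_le hk (hx u) (hx v))
  have h2 := stdGaussian_real_sgn_ne_ge (hx u) (hx v)
  have h3 := abs_le.1 ((abs_real_inner_le_norm (x u) (x v)).trans_eq (by rw [hx, hx, one_mul]))
  have h4 := goemansWilliamsonConstant_mul_le h3.1 h3.2
  simp only
  linarith

/-- Summing the edgewise bounds costs `10 * foolingConstant / √k` times the total weight. As the
latter is at most twice `maxCut`, the loss becomes multiplicative with constant 20. -/
lemma IsKWiseIndepStdGaussianVector.maxCut_le_integral_cutWeight
    (hr : IsKWiseIndepStdGaussianVector k r P') (hk : 0 < k) {G : SimpleGraph V} {w : Sym2 V → ℝ}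
    (hw : ∀ e ∈ G.edgeSet, 0 ≤ w e) {x : V → EuclideanSpace ℝ (Fin n)}
    (hx : IsOptimalSdpSolution G w x) :
    (goemansWilliamsonConstant - 20 * foolingConstant / √k) * maxCut G w
      ≤ ∫ ω, cutWeight G w (fun u => sgn (inner ℝ (x u) (r ω))) ∂P' := by
  classical
  simp only [cutWeight_eq]
  rw [integral_finsetSum _ fun e _ => (hr.integrable_cutIndicator x e).const_mul _]
  simp only [integral_const_mul]
  have h1 : ∑ e ∈ G.edgeFinset,
      w e * (goemansWilliamsonConstant * edgeValue x e - 10 * foolingConstant / √k)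
      ≤ ∑ e ∈ G.edgeFinset,
        w e * ∫ ω, cutIndicator (fun u => sgn (inner ℝ (x u) (r ω))) e ∂P' :=
    Finset.sum_le_sum fun e he => mul_le_mul_of_nonneg_left
      (hr.edgeValue_le_integral_cutIndicator hk hx.1 e) (hw e (SimpleGraph.mem_edgeFinset.1 he))
  have h2 : ∑ e ∈ G.edgeFinset,
      w e * (goemansWilliamsonConstant * edgeValue x e - 10 * foolingConstant / √k)
      = goemansWilliamsonConstant * sdpValue G w x
        - 10 * foolingConstant / √k * ∑ e ∈ G.edgeFinset, w e := by
    rw [sdpValue_eq, Finset.mul_sum, Finset.mul_sum, ← Finset.sum_sub_distrib]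
    exact Finset.sum_congr rfl fun e _ => by ring
  have h3 := mul_le_mul_of_nonneg_left hx.maxCut_le goemansWilliamsonConstant_nonneg
  have h4 : 0 ≤ 10 * foolingConstant / √k := by
    have := eight_le_foolingConstant
    positivity
  have h5 := mul_le_mul_of_nonneg_left (sum_weight_le_two_mul_maxCut G w) h4
  have h6 : (goemansWilliamsonConstant - 20 * foolingConstant / √k) * maxCut G w
      = goemansWilliamsonConstant * maxCut G w
        - 10 * foolingConstant / √k * (2 * maxCut G w) := by ring
  linarith

lemma maxCut_nonneg {G : SimpleGraph V} {w : Sym2 V → ℝ} (hw : ∀ e ∈ G.edgeSet, 0 ≤ w e) :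
    0 ≤ maxCut G w := by
  classical
  have h1 := sum_weight_le_two_mul_maxCut G w
  have h2 : 0 ≤ ∑ e ∈ G.edgeFinset, w e :=
    Finset.sum_nonneg fun e he => hw e (SimpleGraph.mem_edgeFinset.1 he)
  linarith

end MaxCut

/-! ### Choice of the constant and conclusion -/

lemma div_sqrt_lt_of_sq_div_sq_lt {A ε k : ℝ} (hA : 0 ≤ A) (hε : 0 < ε) (h : A ^ 2 / ε ^ 2 < k) :
    A / √k < ε := by
  have hk : 0 < k := lt_of_le_of_lt (by positivity) h
  have h1 : A / ε < √k := by
    rw [Real.lt_sqrt (by positivity), div_pow]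
    exact h
  rw [div_lt_iff₀ (Real.sqrt_pos.2 hk)]
  rw [div_lt_iff₀ hε] at h1
  linarith

theorem mainTheorem6 :
    ∃ C : ℝ, 0 < C ∧
      -- intersections of `m` halfspaces
      (∀ (m : ℕ), 1 < m → ∀ (ε : ℝ), 0 < ε → ∀ (k : ℕ), C * (m : ℝ) ^ 6 / ε ^ 2 ≤ (k : ℝ) →
        ∀ (n : ℕ) (a : Fin m → EuclideanSpace ℝ (Fin n)) (θ : Fin m → ℝ), (∀ i, ‖a i‖ = 1) →
        ∀ {Ω : Type*} [MeasurableSpace Ω] (P : Measure Ω) [IsProbabilityMeasure P]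
          {Ω' : Type*} [MeasurableSpace Ω'] (P' : Measure Ω') [IsProbabilityMeasure P']
          (X : Ω → EuclideanSpace ℝ (Fin n)) (Y : Ω' → EuclideanSpace ℝ (Fin n)),
          IsIndepStdGaussianVector X P → IsKWiseIndepStdGaussianVector k Y P' →
          |P.real {ω | X ω ∈ ⋂ i, halfspace (a i) (θ i)}
            - P'.real {ω | Y ω ∈ ⋂ i, halfspace (a i) (θ i)}| < ε) ∧
      -- intersections of two halfspaces
      (∀ (ε : ℝ), 0 < ε → ∀ (k : ℕ), C / ε ^ 2 ≤ (k : ℝ) →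
        ∀ (n : ℕ) (a b : EuclideanSpace ℝ (Fin n)) (θ₁ θ₂ : ℝ), ‖a‖ = 1 → ‖b‖ = 1 →
        ∀ {Ω : Type*} [MeasurableSpace Ω] (P : Measure Ω) [IsProbabilityMeasure P]
          {Ω' : Type*} [MeasurableSpace Ω'] (P' : Measure Ω') [IsProbabilityMeasure P']
          (X : Ω → EuclideanSpace ℝ (Fin n)) (Y : Ω' → EuclideanSpace ℝ (Fin n)),
          IsIndepStdGaussianVector X P → IsKWiseIndepStdGaussianVector k Y P' →
          |P.real {ω | X ω ∈ halfspace a θ₁ ∩ halfspace b θ₂}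
            - P'.real {ω | Y ω ∈ halfspace a θ₁ ∩ halfspace b θ₂}| < ε) ∧
      -- the probability that hyperplane rounding separates two unit vectors
      (∀ (ε : ℝ), 0 < ε → ∀ (k : ℕ), C / ε ^ 2 ≤ (k : ℝ) →
        ∀ (n : ℕ) (a b : EuclideanSpace ℝ (Fin n)), ‖a‖ = 1 → ‖b‖ = 1 →
        ∀ {Ω : Type*} [MeasurableSpace Ω] (P : Measure Ω) [IsProbabilityMeasure P]
          {Ω' : Type*} [MeasurableSpace Ω'] (P' : Measure Ω') [IsProbabilityMeasure P']
          (X : Ω → EuclideanSpace ℝ (Fin n)) (Y : Ω' → EuclideanSpace ℝ (Fin n)),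
          IsIndepStdGaussianVector X P → IsKWiseIndepStdGaussianVector k Y P' →
          |P.real {ω | sgn (inner ℝ a (X ω)) ≠ sgn (inner ℝ b (X ω))}
            - P'.real {ω | sgn (inner ℝ a (Y ω)) ≠ sgn (inner ℝ b (Y ω))}| < ε) ∧
      -- the approximation ratio of Goemans-Williamson rounding for maximum cut
      (∀ (ε : ℝ), 0 < ε → ∀ (k : ℕ), C / ε ^ 2 ≤ (k : ℝ) →
        ∀ {V : Type*} [Fintype V] (G : SimpleGraph V) (w : Sym2 V → ℝ),
          (∀ e ∈ G.edgeSet, 0 ≤ w e) →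
        ∀ (n : ℕ) (x : V → EuclideanSpace ℝ (Fin n)), IsOptimalSdpSolution G w x →
        ∀ {Ω' : Type*} [MeasurableSpace Ω'] (P' : Measure Ω') [IsProbabilityMeasure P']
          (r : Ω' → EuclideanSpace ℝ (Fin n)), IsKWiseIndepStdGaussianVector k r P' →
          (goemansWilliamsonConstant - ε) * maxCut G w
            ≤ ∫ ω, cutWeight G w (fun u => sgn (inner ℝ (x u) (r ω))) ∂P') := by
  have hD := eight_le_foolingConstant
  have hD2 : 0 < 400 * foolingConstant ^ 2 + 1 := by positivity
  have hpos : ∀ {ε : ℝ} {k : ℕ}, 0 < ε → (400 * foolingConstant ^ 2 + 1) / ε ^ 2 ≤ (k : ℝ) →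
      0 < k := by
    intro ε k hε hk
    have : (0 : ℝ) < k := lt_of_lt_of_le (by positivity) hk
    exact_mod_cast this
  have hlt : ∀ {ε A : ℝ} {k : ℕ}, 0 < ε → (400 * foolingConstant ^ 2 + 1) / ε ^ 2 ≤ (k : ℝ) →
      0 ≤ A → A ≤ 20 * foolingConstant → A / √k < ε := by
    intro ε A k hε hk hA hA'
    refine div_sqrt_lt_of_sq_div_sq_lt hA hε (lt_of_lt_of_le ?_ hk)
    gcongr
    nlinarith
  -- The largest error coefficient in the last three parts is `20 * foolingConstant`, whose square
  -- appears here; the added 1 makes the inequalities strict.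
  refine ⟨400 * foolingConstant ^ 2 + 1, hD2, ?_, ?_, ?_, ?_⟩
  · intro m hm ε hε k hk n a θ ha Ω _ P _ Ω' _ P' _ X Y hX hY
    have hm1 : (1 : ℝ) ≤ m := by exact_mod_cast hm.le
    have hk0 : 0 < k := by
      have : (0 : ℝ) < k := lt_of_lt_of_le (by positivity) hk
      exact_mod_cast this
    have h1 := hY.abs_measureReal_halfspaces_sub_le a θ ha (by lia) hk0
    rw [← hX.hasLaw_stdGaussian.map_eq, (hX.isKWise k).map_real_apply
      (MeasurableSet.iInter fun i => measurableSet_halfspace _ _), abs_sub_comm] at h1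
    refine h1.trans_lt (div_sqrt_lt_of_sq_div_sq_lt (by positivity) hε (lt_of_lt_of_le ?_ hk))
    gcongr
    -- The argument needs only `m ^ 4`; the sixth power follows from `1 ≤ m`.
    calc (foolingConstant * m ^ 2) ^ 2 = foolingConstant ^ 2 * m ^ 4 := by ring
      _ < (400 * foolingConstant ^ 2 + 1) * m ^ 4 := by
        gcongr
        nlinarith
      _ ≤ (400 * foolingConstant ^ 2 + 1) * m ^ 6 := by
        exact mul_le_mul_of_nonneg_left (pow_le_pow_right₀ hm1 (by norm_num)) hD2.le
  · intro ε hε k hk n a b θ₁ θ₂ ha hb Ω _ P _ Ω' _ P' _ X Y hX hY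
    have hS := (measurableSet_halfspace a θ₁).inter (measurableSet_halfspace b θ₂)
    have h1 := hY.abs_map_real_inter_halfspace_sub_le (hpos hε hk) ha hb θ₁ θ₂
    rw [← hX.hasLaw_stdGaussian.map_eq, (hX.isKWise k).map_real_apply hS, hY.map_real_apply hS,
      abs_sub_comm] at h1
    exact h1.trans_lt (hlt hε hk (by positivity) (by linarith))
  · intro ε hε k hk n a b ha hb Ω _ P _ Ω' _ P' _ X Y hX hY
    have h1 := hY.abs_measureReal_sgn_ne_sub_le (hpos hε hk) ha hb
    rw [← hX.hasLaw_stdGaussian.map_eq, (hX.isKWise k).map_real_apply (measurableSet_sgn_ne a b),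
      abs_sub_comm] at h1
    exact h1.trans_lt (hlt hε hk (by positivity) (by linarith))
  · intro ε hε k hk V _ G w hw n x hx Ω' _ P' _ r hr
    refine le_trans ?_ (hr.maxCut_le_integral_cutWeight (hpos hε hk) hw hx)
    have h1 := hlt hε hk (A := 20 * foolingConstant) (by positivity) le_rfl
    exact mul_le_mul_of_nonneg_right (by linarith) (maxCut_nonneg hw)
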